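/- Let $\Bbbk$ be a field. A \emph{finite category} is an abelian $\Bbbk$-linear category with finite-dimensional Hom spaces, in which every object has finite length, there are finitely many isomorphism classes of simple objects, and every simple object has a projective cover. Let $\mathcal C$ be a finite tensor category over $\Bbbk$ (a finite category with a rigid monoidal structure, $\Bbbk$-bilinear tensor product and simple unit object; not necessarily strict), and let $\mathcal B$ be a finite right $\mathcal C$-module category: a finite category with an associative and unital (up to coherent natural isomorphism) right action $\triangleleft:\mathcal B\times\mathcal C\to\mathcal B$ that is $\Bbbk$-bilinear and exact in each variable. For $X\in\mathcal C$ let $X^*$ be the dual with $\mathrm{ev}:X^*\otimes X\to\mathbf 1$, $\mathrm{coev}:\mathbf 1\to X\otimes X^*$, and let ${}^*X$ be the dual with $\mathrm{ev}:X\otimes{}^*X\to\mathbf 1$, $\mathrm{coev}:\mathbf 1\to{}^*X\otimes X$. Let $\mathrm{Rex}_{\mathcal C}(\mathcal B,\mathcal C)$ be the category of right exact $\Bbbk$-linear $\mathcal C$-module functors $(F,c)$, $c_{B,X}:F(B\triangleleft X)\xrightarrow{\sim}F(B)\otimes X$, and natural module transformations. A \emph{prebalancing} of a functor $S:\mathcal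 B^{\mathrm{op}}\times\mathcal B\to\mathcal A$ is a natural isomorphism $\gamma^X_{A,B}:S(A\triangleleft X,B)\to S(A,B\triangleleft{}^*X)$. The \emph{relative coend} $\oint^{B\in\mathcal B}(S(B,B),\gamma)$ is an object $E\in\mathcal A$ with a dinatural transformation $\lambda_B:S(B,B)\to E$ such that for all $B\in\mathcal B$, $X\in\mathcal C$ the two morphisms $S(B\triangleleft({}^*X\otimes X),B)\to E$, $$\lambda_B\circ S(\mathrm{id}_B\triangleleft\mathrm{coev}_X,\mathrm{id}_B)\quad\text{and}\quad \lambda_{B\triangleleft{}^*X}\circ\gamma^X_{B\triangleleft{}^*X,B}\circ S(m^{-1},\mathrm{id}_B),$$ coincide, where $m:B\triangleleft({}^*X\otimes X)\cong(B\triangleleft{}^*X)\triangleleft X$ is the associativity isomorphism (and $B\cong B\triangleleft\mathbf 1$ is used implicitly), and which is universal with these properties. For $(F,c)\in\mathrm{Rex}_{\mathcal C}(\mathcal B,\mathcal C)$ the functor $(A,B)\mapsto B\triangleleft{}^*F(A)$ has the canonical prebalancing $\gamma$ given by ${}^*(c_{A,X}^{-1})$, followed by ${}^*(F(A)\otimes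 X)\cong{}^*X\otimes{}^*F(A)$ and the associativity of the action. For $(F,c),(\widetilde F,\tilde c)\in\mathrm{Rex}_{\mathcal C}(\mathcal B,\mathcal C)$ the functor $(A,B)\mapsto\widetilde F(B)\otimes{}^*F(A)$ has the canonical prebalancing $\beta$ given by the same composite followed by $\tilde c^{-1}_{B,{}^*X}\otimes\mathrm{id}$. Then: (1) For all $D,B\in\mathcal B$ the internal Hom $\underline{\mathrm{Hom}}(D,B)\in\mathcal C$ exists, i.e. an object representing $X\mapsto\mathrm{Hom}_{\mathcal B}(D\triangleleft X,B)$. Hence there is a functor $$\Phi:\mathcal B^{\mathrm{op}}\to\mathrm{Rex}_{\mathcal C}(\mathcal B,\mathcal C),\qquad \Phi(B)(D)=\underline{\mathrm{Hom}}(D,B)^*,$$ with its canonical module structure $\underline{\mathrm{Hom}}(D\triangleleft X,B)^*\cong\underline{\mathrm{Hom}}(D,B)^*\otimes X$. (2) For every $(F,c)\in\mathrm{Rex}_{\mathcal C}(\mathcal B,\mathcal C)$ the relative coend $\oint^{B\in\mathcal B}(B\triangleleft{}^*F(B),\gamma)\in\mathcal B$ exists. (3) The assignment $(F,c)\mapsto\oint^{B\in\mathcal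 B}(B\triangleleft{}^*F(B),\gamma)$, made into a functor $\mathrm{Rex}_{\mathcal C}(\mathcal B,\mathcal C)\to\mathcal B^{\mathrm{op}}$ by the universal property (for any choice of the coends and of the internal Homs), is a quasi-inverse of $\Phi$: both composites are naturally isomorphic to the identity functors. (4) For all $(F,c),(\widetilde F,\tilde c)\in\mathrm{Rex}_{\mathcal C}(\mathcal B,\mathcal C)$ the relative coend $\oint^{B\in\mathcal B}(\widetilde F(B)\otimes{}^*F(B),\beta)\in\mathcal C$ exists. -/

import Mathlib

open CategoryTheory MonoidalCategory MonoidalRightAction Opposite Limits HasLeftDual HasRightDual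

universe w v₁ v₂ v₃ u₁ u₂ u₃

namespace RelCoend

section FiniteCategories

/-- `X` has a projective cover: an epimorphism `p : P ⟶ X` from a projective object which is
essential, i.e. any `g : Q ⟶ P` with `g ≫ p` epi is itself epi. -/
def HasProjectiveCover {A : Type u₁} [Category.{v₁} A] (X : A) : Prop :=
  ∃ (P : A) (p : P ⟶ X), Projective P ∧ Epi p ∧ ∀ (Q : A) (g : Q ⟶ P), Epi (g ≫ p) → Epi g

/-- Finite abelian `k`-linear categories: finite-dimensional Hom spaces, every object of finite
length (both Noetherian and Artinian), finitely many isomorphism classes of simple objects, and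
every simple object has a projective cover. -/
class IsFiniteLinearCategory (k : Type w) [Field k] (A : Type u₁) [Category.{v₁} A] [Abelian A]
    [Linear k A] : Prop where
  finite_hom (X Y : A) : Module.Finite k (X ⟶ Y)
  noetherian (X : A) : IsNoetherianObject X
  artinian (X : A) : IsArtinianObject X
  finite_simples : ∃ (n : ℕ) (S : Fin n → A), ∀ X : A, Simple X → ∃ i, Nonempty (X ≅ S i)
  projective_cover (X : A) : Simple X → HasProjectiveCover X

/-- Finite tensor categories over `k` (rigidity is the instance `RigidCategory C`):
finite `k`-linear abelian, with `k`-bilinear tensor product and simple unit object. -/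
class IsFiniteTensorCategory (k : Type w) [Field k] (C : Type u₁) [Category.{v₁} C] [Abelian C]
    [Linear k C] [MonoidalCategory C] [RigidCategory C] : Prop extends
    IsFiniteLinearCategory k C, MonoidalPreadditive C, MonoidalLinear k C where
  simple_unit : Simple (𝟙_ C)

/-- Finite right module categories: a finite `k`-linear abelian category with a right action
(associativity and unit isomorphisms with their coherences are in `MonoidalRightAction C M`)
which is `k`-bilinear and exact in each variable. -/
class IsFiniteModuleCategory (k : Type w) [Field k] (C : Type u₁) [Category.{v₁} C] [Abelian C]
    [Linear k C] [MonoidalCategory C] (M : Type u₂) [Category.{v₂} M] [Abelian M] [Linear k M]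
    [MonoidalRightAction C M] : Prop extends IsFiniteLinearCategory k M where
  additive_actionRight (X : C) : (actionRight M X).Additive
  linear_actionRight (X : C) : (actionRight M X).Linear k
  preservesFiniteLimits_actionRight (X : C) : PreservesFiniteLimits (actionRight M X)
  preservesFiniteColimits_actionRight (X : C) : PreservesFiniteColimits (actionRight M X)
  additive_actionLeft (D : M) : (actionLeft C D).Additive
  linear_actionLeft (D : M) : (actionLeft C D).Linear k
  preservesFiniteLimits_actionLeft (D : M) : PreservesFiniteLimits (actionLeft C D)
  preservesFiniteColimits_actionLeft (D : M) : PreservesFiniteColimits (actionLeft C D)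

attribute [instance] IsFiniteModuleCategory.additive_actionRight
  IsFiniteModuleCategory.linear_actionRight
  IsFiniteModuleCategory.additive_actionLeft
  IsFiniteModuleCategory.linear_actionLeft

end FiniteCategories

section ModuleFunctors

variable (k : Type w) [Field k] (C : Type u₁) [Category.{v₁} C] [MonoidalCategory C]
  (M : Type u₂) [Category.{v₂} M] [Preadditive M] [Linear k M] [MonoidalRightAction C M]
  (N : Type u₃) [Category.{v₃} N] [Preadditive N] [Linear k N] [MonoidalRightAction C N]

/-- Right exact (`k`-linear) `C`-module functors between right `C`-module categories. In the
structure `Functor.RightLinear`, the isomorphism `δᵣ F B X : F (B ⊙ᵣ X) ⟶ F B ⊙ᵣ X` is the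
module structure `c_{B,X}`, with inverse `μᵣ F B X`. -/
structure RexModuleFunctor where
  functor : M ⥤ N
  [rightLinear : functor.RightLinear C]
  [additive : functor.Additive]
  [linear : functor.Linear k]
  [rightExact : PreservesFiniteColimits functor]

attribute [instance] RexModuleFunctor.rightLinear RexModuleFunctor.additive
  RexModuleFunctor.linear RexModuleFunctor.rightExact

variable {k C M N}

/-- Natural module transformations. -/
@[ext]
structure RexModuleFunctor.Hom (F G : RexModuleFunctor k C M N) where
  natTrans : F.functor ⟶ G.functor
  comm (B : M) (X : C) :
    natTrans.app (B ⊙ᵣ X) ≫ Functor.OplaxRightLinear.δᵣ G.functor B X =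
      Functor.OplaxRightLinear.δᵣ F.functor B X ≫ natTrans.app B ⊵ᵣ X

/-- The category `Rex_C(M, N)` of right exact module functors and natural module
transformations. -/
instance : Category (RexModuleFunctor k C M N) where
  Hom F G := RexModuleFunctor.Hom F G
  id F := ⟨𝟙 _, by intro B X; simp⟩
  comp α β := ⟨α.natTrans ≫ β.natTrans, by
    intro B X
    rw [NatTrans.comp_app, NatTrans.comp_app, Category.assoc, β.comm, ← Category.assoc, α.comm,
      Category.assoc, comp_actionHomLeft]⟩
  id_comp α := RexModuleFunctor.Hom.ext (Category.id_comp _)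
  comp_id α := RexModuleFunctor.Hom.ext (Category.comp_id _)
  assoc α β γ := RexModuleFunctor.Hom.ext (Category.assoc _ _ _)

@[ext]
lemma RexModuleFunctor.hom_ext {F G : RexModuleFunctor k C M N} {α β : F ⟶ G}
    (h : ∀ B, α.natTrans.app B = β.natTrans.app B) : α = β :=
  RexModuleFunctor.Hom.ext (by ext B; exact h B)

@[simp]
lemma RexModuleFunctor.id_natTrans (F : RexModuleFunctor k C M N) :
    (𝟙 F : F ⟶ F).natTrans = 𝟙 F.functor := rfl

@[simp]
lemma RexModuleFunctor.comp_natTrans {F G H : RexModuleFunctor k C M N} (α : F ⟶ G)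
    (β : G ⟶ H) : (α ≫ β).natTrans = α.natTrans ≫ β.natTrans := rfl

variable (C M) in
/-- The identity functor as a module functor. -/
instance idRightLinear : (𝟭 M).RightLinear C where
  μᵣ B X := 𝟙 (B ⊙ᵣ X)
  δᵣ B X := 𝟙 (B ⊙ᵣ X)
  μᵣ_naturality_right := by intros; simp [-action_actionHomRight]
  μᵣ_naturality_left := by intros; simp
  μᵣ_associativity := by intros; simp
  μᵣ_unitality := by intros; simp
  δᵣ_naturality_right := by intros; simp [-action_actionHomRight]
  δᵣ_naturality_left := by intros; simp
  δᵣ_associativity := by intros; simp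
  δᵣ_unitality_inv := by intros; simp
  μᵣ_comp_δᵣ := by intros; simp
  δᵣ_comp_μᵣ := by intros; simp

end ModuleFunctors

section OplaxToStrong

variable {C : Type u₁} [Category.{v₁} C] [MonoidalCategory C]
  {M : Type u₂} [Category.{v₂} M] [MonoidalRightAction C M]
  {N : Type u₃} [Category.{v₃} N] [MonoidalRightAction C N]

open Functor.OplaxRightLinear in
/-- A module functor from an oplax one all of whose structure morphisms are isomorphisms. -/
@[reducible]
noncomputable def rightLinearOfIsIso (F : M ⥤ N) [F.OplaxRightLinear C]
    (h : ∀ (B : M) (X : C), IsIso (δᵣ F B X)) : F.RightLinear C where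
  μᵣ B X := inv (δᵣ F B X)
  μᵣ_naturality_right B X X' f := by
    rw [IsIso.comp_inv_eq, Category.assoc, δᵣ_naturality_right, IsIso.inv_hom_id_assoc]
  μᵣ_naturality_left f X := by
    rw [IsIso.comp_inv_eq, Category.assoc, δᵣ_naturality_left, IsIso.inv_hom_id_assoc]
  μᵣ_associativity B X Y := by
    rw [IsIso.inv_comp_eq, ← Category.assoc, δᵣ_associativity]
    simp
  μᵣ_unitality B := by
    rw [IsIso.eq_inv_comp, δᵣ_unitality_hom]
  μᵣ_comp_δᵣ B X := IsIso.inv_hom_id _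
  δᵣ_comp_μᵣ B X := IsIso.hom_inv_id _

end OplaxToStrong

section RelativeCoends

variable {C : Type u₁} [Category.{v₁} C] [MonoidalCategory C] [LeftRigidCategory C]
  {M : Type u₂} [Category.{v₂} M] [MonoidalRightAction C M]
  {A : Type u₃} [Category.{v₃} A]

variable (C) in
/-- A `C`-prebalancing of a functor `S : Mᵒᵖ × M ⥤ A`, for `M` a right `C`-module category:
isomorphisms `γ^X_{B,D} : S(B ◁ X, D) ≅ S(B, D ◁ ᘁX)` natural in `B`, `D` and `X`. Here `ᘁX` is
the dual of `X` with evaluation `X ⊗ ᘁX ⟶ 𝟙` and coevaluation `𝟙 ⟶ ᘁX ⊗ X`. -/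
structure Prebalancing (S : Mᵒᵖ ⥤ M ⥤ A) where
  iso (X : C) (B D : M) :
    (S.obj (op (B ⊙ᵣ X))).obj D ≅ (S.obj (op B)).obj (D ⊙ᵣ leftDual X)
  naturality_fst (X : C) {B B' : M} (f : B ⟶ B') (D : M) :
    (S.map (f ⊵ᵣ X).op).app D ≫ (iso X B D).hom =
      (iso X B' D).hom ≫ (S.map f.op).app (D ⊙ᵣ leftDual X)
  naturality_snd (X : C) (B : M) {D D' : M} (g : D ⟶ D') :
    (S.obj (op (B ⊙ᵣ X))).map g ≫ (iso X B D').hom =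
      (iso X B D).hom ≫ (S.obj (op B)).map (g ⊵ᵣ leftDual X)
  naturality_obj {X Y : C} (h : X ⟶ Y) (B D : M) :
    (S.map (B ⊴ᵣ h).op).app D ≫ (iso X B D).hom =
      (iso Y B D).hom ≫ (S.obj (op B)).map (D ⊴ᵣ leftAdjointMate h)

/-- The condition on a family `π B : S(B, B) ⟶ T` imposed in the definition of relative
coends: for all `B`, `X`, the two composites `S(B ◁ (ᘁX ⊗ X), B) ⟶ T`, through `S(B, B)` via the
coevaluation of `X`, and through `S(B ◁ ᘁX, B ◁ ᘁX)` via the prebalancing, agree. -/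
def IsBalanced {S : Mᵒᵖ ⥤ M ⥤ A} (γ : Prebalancing C S) {T : A}
    (π : ∀ B : M, (S.obj (op B)).obj B ⟶ T) : Prop :=
  ∀ (X : C) (B : M),
    (S.map ((ρᵣ[C] B).inv ≫ B ⊴ᵣ η_ (leftDual X) X).op).app B ≫ π B =
      (S.map (αᵣ B (leftDual X) X).inv.op).app B ≫ (γ.iso X (B ⊙ᵣ leftDual X) B).hom ≫
        π (B ⊙ᵣ leftDual X)

/-- Dinaturality of a family `π B : S(B, B) ⟶ T`. -/
def IsDinatural (S : Mᵒᵖ ⥤ M ⥤ A) {T : A} (π : ∀ B : M, (S.obj (op B)).obj B ⟶ T) : Prop :=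
  ∀ ⦃B B' : M⦄ (f : B ⟶ B'),
    (S.map f.op).app B ≫ π B = (S.obj (op B')).map f ≫ π B'

/-- A relative coend of `(S, γ)`: an object `pt` with a dinatural transformation
`π B : S(B, B) ⟶ pt` satisfying the balancing condition, universal with this property. -/
structure RelativeCoend {S : Mᵒᵖ ⥤ M ⥤ A} (γ : Prebalancing C S) where
  pt : A
  π (B : M) : (S.obj (op B)).obj B ⟶ pt
  dinatural : IsDinatural S π
  balanced : IsBalanced γ π
  desc {T : A} (ξ : ∀ B : M, (S.obj (op B)).obj B ⟶ T) (hd : IsDinatural S ξ)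
    (hb : IsBalanced γ ξ) : pt ⟶ T
  fac {T : A} (ξ : ∀ B : M, (S.obj (op B)).obj B ⟶ T) (hd : IsDinatural S ξ)
    (hb : IsBalanced γ ξ) (B : M) : π B ≫ desc ξ hd hb = ξ B
  hom_ext {T : A} {f g : pt ⟶ T} (h : ∀ B, π B ≫ f = π B ≫ g) : f = g


end RelativeCoends

section LeftDuals

variable {C : Type u₁} [Category.{v₁} C] [MonoidalCategory C]

lemma leftDual_hom_ext {X Z : C} [HasLeftDual X] {f g : Z ⟶ leftDual X}
    (h : X ◁ f ≫ ε_ (leftDual X) X = X ◁ g ≫ ε_ (leftDual X) X) : f = g := by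
  have h' := congrArg (tensorLeftHomEquiv Z (leftDual X) X (𝟙_ C)) h
  rw [tensorLeftHomEquiv_whiskerLeft_comp_evaluation,
    tensorLeftHomEquiv_whiskerLeft_comp_evaluation] at h'
  exact (cancel_mono _).1 h'

lemma leftAdjointMate_tensor {X X' Y Y' : C} [HasLeftDual X] [HasLeftDual Y] [HasLeftDual X']
    [HasLeftDual Y'] (f : X ⟶ X') (g : Y ⟶ Y') :
    @leftAdjointMate C _ _ (X ⊗ Y) (X' ⊗ Y') (hasLeftDualTensor) (hasLeftDualTensor) (f ⊗ₘ g) =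
      (leftAdjointMate g ⊗ₘ leftAdjointMate f) := by
  let _ : HasLeftDual (X ⊗ Y) := hasLeftDualTensor
  let _ : HasLeftDual (X' ⊗ Y') := hasLeftDualTensor
  apply leftDual_hom_ext
  rw [leftAdjointMate_comp_evaluation]
  change (f ⊗ₘ g) ▷ (leftDual Y' ⊗ leftDual X') ≫ ε_ (leftDual Y' ⊗ leftDual X') (X' ⊗ Y') =
    (X ⊗ Y) ◁ (leftAdjointMate g ⊗ₘ leftAdjointMate f) ≫ ε_ (leftDual Y ⊗ leftDual X) (X ⊗ Y)
  rw [ExactPairing.tensor_evaluation, ExactPairing.tensor_evaluation]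
  calc _ = 𝟙 _ ⊗≫ X ◁ ((g ▷ leftDual Y' ≫ ε_ (leftDual Y') Y') ▷ (leftDual X')) ⊗≫ (f ▷ leftDual X' ≫ ε_ (leftDual X') X') := by
        rw [MonoidalCategory.tensorHom_def', comp_whiskerRight]
        have : (f ▷ Y') ▷ (leftDual Y' ⊗ leftDual X') ⊗≫ X' ◁ (ε_ (leftDual Y') Y' ▷ leftDual X') ⊗≫ 𝟙 (X' ⊗ leftDual X') = 𝟙 _ ⊗≫ X ◁ (ε_ (leftDual Y') Y' ▷ leftDual X') ⊗≫ f ▷ leftDual X' := by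
          calc _ = 𝟙 _ ⊗≫ (f ▷ ((Y' ⊗ leftDual Y') ⊗ leftDual X') ≫ X' ◁ (ε_ (leftDual Y') Y' ▷ leftDual X')) ⊗≫ 𝟙 _ := by monoidal
            _ = _ := by rw [← whisker_exchange]; monoidal
        calc _ = (X ◁ g) ▷ _ ≫ ((f ▷ Y') ▷ (leftDual Y' ⊗ leftDual X') ⊗≫ X' ◁ (ε_ (leftDual Y') Y' ▷ leftDual X') ⊗≫ 𝟙 (X' ⊗ leftDual X')) ≫ ε_ (leftDual X') X' := by monoidal
          _ = _ := by rw [this]; monoidal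
    _ = 𝟙 _ ⊗≫ X ◁ ((Y ◁ (leftAdjointMate g) ≫ ε_ (leftDual Y) Y) ▷ (leftDual X')) ⊗≫ (X ◁ leftAdjointMate f ≫ ε_ (leftDual X) X) := by
        rw [leftAdjointMate_comp_evaluation, leftAdjointMate_comp_evaluation]
    _ = _ := by
        rw [MonoidalCategory.tensorHom_def]
        have : X ◁ (ε_ (leftDual Y) Y ▷ leftDual X') ⊗≫ X ◁ leftAdjointMate f = 𝟙 _ ⊗≫ (X ⊗ (Y ⊗ leftDual Y)) ◁ leftAdjointMate f ⊗≫ X ◁ (ε_ (leftDual Y) Y ▷ leftDual X) ⊗≫ 𝟙 _ := by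
          calc _ = 𝟙 _ ⊗≫ X ◁ (ε_ (leftDual Y) Y ▷ leftDual X' ≫ 𝟙_ C ◁ leftAdjointMate f) ⊗≫ 𝟙 _ := by monoidal
            _ = _ := by rw [← whisker_exchange]; monoidal
        calc _ = 𝟙 _ ⊗≫ X ◁ ((Y ◁ (leftAdjointMate g)) ▷ (leftDual X')) ⊗≫ (X ◁ (ε_ (leftDual Y) Y ▷ leftDual X') ⊗≫ X ◁ leftAdjointMate f) ⊗≫ ε_ (leftDual X) X := by monoidal
          _ = _ := by rw [this]; monoidal

end LeftDuals

section DualPrebalancing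

variable {C : Type u₁} [Category.{v₁} C] [MonoidalCategory C] [LeftRigidCategory C]
  {M : Type u₂} [Category.{v₂} M] [MonoidalRightAction C M]
  {N : Type u₃} [Category.{v₃} N] [MonoidalRightAction C N]

/-- The functor `Mᵒᵖ × M ⥤ N`, `(B, D) ↦ G(D) ◁ ᘁF(B)`. -/
def dualBifunctor (F : M ⥤ C) (G : M ⥤ N) : Mᵒᵖ ⥤ M ⥤ N where
  obj B :=
    { obj D := G.obj D ⊙ᵣ leftDual (F.obj B.unop)
      map g := G.map g ⊵ᵣ leftDual (F.obj B.unop)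
      map_id D := by simp
      map_comp f g := by simp }
  map f :=
    { app D := G.obj D ⊴ᵣ leftAdjointMate (F.map f.unop)
      naturality D D' g := by simp [action_exchange] }
  map_id B := by
    ext D
    simp
  map_comp f g := by
    ext D
    simp [comp_leftAdjointMate]

lemma leftDualTensorIso_naturality {X X' Y Y' : C} (f : X ⟶ X')
    (g : Y ⟶ Y') :
    leftAdjointMate (f ⊗ₘ g) ≫ (leftDualTensorIso X Y).hom =
      (leftDualTensorIso X' Y').hom ≫ (leftAdjointMate g ⊗ₘ leftAdjointMate f) := by
  rw [← leftAdjointMate_tensor]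
  dsimp only [leftDualTensorIso, leftDualIso]
  refine (@comp_leftAdjointMate C _ _ (X ⊗ Y) (X ⊗ Y) (X' ⊗ Y') hasLeftDualTensor _ _ (𝟙 _) (f ⊗ₘ g)).symm.trans ?_
  refine Eq.trans ?_ (@comp_leftAdjointMate C _ _ (X ⊗ Y) (X' ⊗ Y') (X' ⊗ Y') hasLeftDualTensor hasLeftDualTensor _ (f ⊗ₘ g) (𝟙 _))
  rw [Category.id_comp, Category.comp_id]

/-- The isomorphism `ᘁX ≅ ᘁY` dual to (the inverse of) an isomorphism `e : X ≅ Y`. -/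
def leftDualMapIso {X Y : C} (e : X ≅ Y) : leftDual X ≅ leftDual Y where
  hom := leftAdjointMate e.inv
  inv := leftAdjointMate e.hom
  hom_inv_id := by rw [← comp_leftAdjointMate, e.hom_inv_id, leftAdjointMate_id]
  inv_hom_id := by rw [← comp_leftAdjointMate, e.inv_hom_id, leftAdjointMate_id]

/-- The module structure `F(B ◁ X) ≅ F(B) ⊗ X` of a module functor to `C`. -/
def moduleIso (F : M ⥤ C) [F.RightLinear C] (B : M) (X : C) :
    F.obj (B ⊙ᵣ X) ≅ F.obj B ⊗ X :=
  (Functor.RightLinear.μᵣIso F B X).symm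

/-- The isomorphism `ᘁF(B ◁ X) ≅ ᘁ(F(B) ⊗ X) ≅ ᘁX ⊗ ᘁF(B)`. -/
def dualModuleIso (F : M ⥤ C) [F.RightLinear C] (B : M) (X : C) :
    leftDual (F.obj (B ⊙ᵣ X)) ≅ leftDual X ⊗ leftDual (F.obj B) :=
  leftDualMapIso (moduleIso F B X) ≪≫ leftDualTensorIso (F.obj B) X

/-- The composite isomorphism `G(D) ◁ ᘁF(B ◁ X) ≅ G(D) ◁ (ᘁX ⊗ ᘁF(B)) ≅ (G(D) ◁ ᘁX) ◁ ᘁF(B)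
≅ G(D ◁ ᘁX) ◁ ᘁF(B)`. -/
def dualPrebalancingIso (F : M ⥤ C) [F.RightLinear C] (G : M ⥤ N) [G.RightLinear C]
    (X : C) (B D : M) :
    G.obj D ⊙ᵣ leftDual (F.obj (B ⊙ᵣ X)) ≅ G.obj (D ⊙ᵣ leftDual X) ⊙ᵣ leftDual (F.obj B) :=
  (actionLeft C (G.obj D)).mapIso (dualModuleIso F B X) ≪≫
    αᵣ (G.obj D) (leftDual X) (leftDual (F.obj B)) ≪≫
      (actionRight N (leftDual (F.obj B))).mapIso (Functor.RightLinear.μᵣIso G D (leftDual X))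

lemma dualPrebalancingIso_hom (F : M ⥤ C) [F.RightLinear C] (G : M ⥤ N) [G.RightLinear C]
    (X : C) (B D : M) :
    (dualPrebalancingIso F G X B D).hom = G.obj D ⊴ᵣ (dualModuleIso F B X).hom ≫
      (αᵣ (G.obj D) (leftDual X) (leftDual (F.obj B))).hom ≫
        Functor.LaxRightLinear.μᵣ G D (leftDual X) ⊵ᵣ leftDual (F.obj B) := rfl

lemma dualModuleIso_naturality_left (F : M ⥤ C) [F.RightLinear C] {B B' : M} (f : B ⟶ B')
    (X : C) :
    leftAdjointMate (F.map (f ⊵ᵣ X)) ≫ (dualModuleIso F B X).hom =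
      (dualModuleIso F B' X).hom ≫ leftDual X ◁ leftAdjointMate (F.map f) := by
  have h₁ : leftAdjointMate (F.map (f ⊵ᵣ X)) ≫ leftAdjointMate (moduleIso F B X).inv =
      leftAdjointMate (moduleIso F B' X).inv ≫ leftAdjointMate (F.map f ⊗ₘ 𝟙 X) := by
    rw [← comp_leftAdjointMate, ← comp_leftAdjointMate, MonoidalCategory.tensorHom_id]
    exact congrArg (fun t => leftAdjointMate t)
      (Functor.LaxRightLinear.μᵣ_naturality_left F f X).symm
  have h₂ := leftDualTensorIso_naturality (F.map f) (𝟙 X)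
  rw [leftAdjointMate_id, MonoidalCategory.id_tensorHom] at h₂
  dsimp only [dualModuleIso, leftDualMapIso, Iso.trans_hom]
  rw [reassoc_of% h₁, h₂, Category.assoc]

lemma dualModuleIso_naturality_right (F : M ⥤ C) [F.RightLinear C] (B : M) {X Y : C}
    (h : X ⟶ Y) :
    leftAdjointMate (F.map (B ⊴ᵣ h)) ≫ (dualModuleIso F B X).hom =
      (dualModuleIso F B Y).hom ≫ leftAdjointMate h ▷ leftDual (F.obj B) := by
  have h₁ : leftAdjointMate (F.map (B ⊴ᵣ h)) ≫ leftAdjointMate (moduleIso F B X).inv =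
      leftAdjointMate (moduleIso F B Y).inv ≫ leftAdjointMate (𝟙 (F.obj B) ⊗ₘ h) := by
    rw [← comp_leftAdjointMate, ← comp_leftAdjointMate, MonoidalCategory.id_tensorHom]
    exact congrArg (fun t => leftAdjointMate t)
      (Functor.LaxRightLinear.μᵣ_naturality_right F B h).symm
  have h₂ := leftDualTensorIso_naturality (𝟙 (F.obj B)) h
  rw [leftAdjointMate_id, MonoidalCategory.tensorHom_id] at h₂
  dsimp only [dualModuleIso, leftDualMapIso, Iso.trans_hom]
  rw [reassoc_of% h₁, h₂, Category.assoc]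

/-- The canonical prebalancing of `(B, D) ↦ G(D) ◁ ᘁF(B)` for module functors
`F : M ⥤ C` and `G : M ⥤ N`. -/
def dualPrebalancing (F : M ⥤ C) [F.RightLinear C] (G : M ⥤ N) [G.RightLinear C] :
    Prebalancing C (dualBifunctor F G) where
  iso X B D := dualPrebalancingIso F G X B D
  naturality_fst X B B' f D := by
    change G.obj D ⊴ᵣ leftAdjointMate (F.map (f ⊵ᵣ X)) ≫ (dualPrebalancingIso F G X B D).hom =
      (dualPrebalancingIso F G X B' D).hom ≫
        G.obj (D ⊙ᵣ leftDual X) ⊴ᵣ leftAdjointMate (F.map f)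
    rw [dualPrebalancingIso_hom, dualPrebalancingIso_hom, ← actionHomRight_comp_assoc,
      dualModuleIso_naturality_left, actionHomRight_comp, whiskerRight_actionHomLeft]
    simp only [Category.assoc, Iso.inv_hom_id_assoc]
    rw [action_exchange]
  naturality_snd X B D D' g := by
    change G.map g ⊵ᵣ leftDual (F.obj (B ⊙ᵣ X)) ≫ (dualPrebalancingIso F G X B D').hom =
      (dualPrebalancingIso F G X B D).hom ≫
        G.map (g ⊵ᵣ leftDual X) ⊵ᵣ leftDual (F.obj B)
    rw [dualPrebalancingIso_hom, dualPrebalancingIso_hom, ← action_exchange_assoc,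
      actionHomLeft_tensor]
    simp only [Category.assoc, Iso.inv_hom_id_assoc]
    rw [← comp_actionHomLeft, ← comp_actionHomLeft, Functor.LaxRightLinear.μᵣ_naturality_left]
  naturality_obj {X Y} h B D := by
    change G.obj D ⊴ᵣ leftAdjointMate (F.map (B ⊴ᵣ h)) ≫ (dualPrebalancingIso F G X B D).hom =
      (dualPrebalancingIso F G Y B D).hom ≫
        G.map (D ⊴ᵣ leftAdjointMate h) ⊵ᵣ leftDual (F.obj B)
    rw [dualPrebalancingIso_hom, dualPrebalancingIso_hom, ← actionHomRight_comp_assoc,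
      dualModuleIso_naturality_right, actionHomRight_comp, actionHomRight_whiskerRight]
    simp only [Category.assoc, Iso.inv_hom_id_assoc]
    rw [← comp_actionHomLeft, ← comp_actionHomLeft, Functor.LaxRightLinear.μᵣ_naturality_right]

end DualPrebalancing

section InternalHom

variable {C : Type u₁} [Category.{v₁} C] [MonoidalCategory C]
  {M : Type u₂} [Category.{v₂} M] [MonoidalRightAction C M]

variable (C) in
/-- An internal Hom of `D` and `B`: an object of `C` representing the functor
`Hom_M(D ◁ -, B) : Cᵒᵖ ⥤ Type`. -/
structure InternalHom (D B : M) where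
  obj : C
  representableBy : ((actionLeft C D).op ⋙ yoneda.obj B).RepresentableBy obj

namespace InternalHom

variable {D B : M} (H : InternalHom C D B)

/-- The evaluation `D ◁ Hom(D, B) ⟶ B`. -/
def ev : D ⊙ᵣ H.obj ⟶ B := H.representableBy.homEquiv (𝟙 H.obj)

/-- The morphism `X ⟶ Hom(D, B)` corresponding to `f : D ◁ X ⟶ B`. -/
def lift {X : C} (f : D ⊙ᵣ X ⟶ B) : X ⟶ H.obj := H.representableBy.homEquiv.symm f

lemma lift_ev {X : C} (f : D ⊙ᵣ X ⟶ B) : D ⊴ᵣ H.lift f ≫ H.ev = f := by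
  have h := H.representableBy.homEquiv_comp (H.lift f) (𝟙 H.obj)
  rw [Category.comp_id] at h
  exact h.symm.trans (Equiv.apply_symm_apply _ _)

lemma hom_ext {X : C} {f g : X ⟶ H.obj} (h : D ⊴ᵣ f ≫ H.ev = D ⊴ᵣ g ≫ H.ev) : f = g := by
  apply H.representableBy.homEquiv.injective
  have hf := H.representableBy.homEquiv_comp f (𝟙 H.obj)
  have hg := H.representableBy.homEquiv_comp g (𝟙 H.obj)
  rw [Category.comp_id] at hf hg
  exact hf.trans (Eq.trans h hg.symm)

end InternalHom

/-- For an exact pairing `(X, Y)`, the adjunction bijection `Hom(D ◁ X, E) ≃ Hom(D, E ◁ Y)`. -/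
def actionHomEquiv (X Y : C) [ExactPairing X Y] (D E : M) : (D ⊙ᵣ X ⟶ E) ≃ (D ⟶ E ⊙ᵣ Y) where
  toFun f := (ρᵣ[C] D).inv ≫ D ⊴ᵣ η_ X Y ≫ (αᵣ D X Y).hom ≫ f ⊵ᵣ Y
  invFun g := g ⊵ᵣ X ≫ (αᵣ E Y X).inv ≫ E ⊴ᵣ ε_ X Y ≫ (ρᵣ[C] E).hom
  left_inv f := by
    have h := congrArg (fun t => (ρᵣ[C] D).inv ⊵ᵣ X ≫ (αᵣ D (𝟙_ C) X).inv ≫ D ⊴ᵣ t)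
      (ExactPairing.evaluation_coevaluation X Y)
    simp only [actionHomRight_comp, actionHomRight_whiskerRight, whiskerRight_actionHomLeft,
      Category.assoc, Iso.inv_hom_id_assoc] at h
    rw [← cancel_mono ((αᵣ D X (𝟙_ C)).hom ≫ (ρᵣ (D ⊙ᵣ X)).hom)] at h
    have h₂ := action_exchange f (ε_ X Y)
    rw [← cancel_mono (ρᵣ E).hom] at h₂
    simp only [Category.assoc, ← actionUnitIso_hom_naturality] at h₂
    simp only [comp_actionHomLeft, Category.assoc]
    have h₃ : (f ⊵ᵣ Y) ⊵ᵣ X ≫ (αᵣ E Y X).inv = (αᵣ (D ⊙ᵣ X) Y X).inv ≫ f ⊵ᵣ (Y ⊗ X) := by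
      simp
    rw [reassoc_of% h₃, ← h₂]
    simp only [← Category.assoc]
    refine Eq.trans (congrArg (· ≫ f) ?_) (Category.id_comp f)
    simp only [Category.assoc]
    have h₄ : (αᵣ D X Y).hom ⊵ᵣ X ≫ (αᵣ (D ⊙ᵣ X) Y X).inv =
        (αᵣ D (X ⊗ Y) X).inv ≫ D ⊴ᵣ (α_ X Y X).hom ≫ (αᵣ D X (Y ⊗ X)).hom := by
      rw [Iso.eq_inv_comp, ← Category.assoc, Iso.comp_inv_eq, Category.assoc,
        actionHom_associator]
    rw [reassoc_of% h₄]
    simp only [Category.assoc, Iso.inv_hom_id_assoc] at h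
    rw [h, ← actionHom_rightUnitor, ← actionHomRight_comp, ← actionHomRight_comp]
    simp
  right_inv g := by
    have h := congrArg (fun t => (ρᵣ (E ⊙ᵣ Y)).inv ≫ (αᵣ E Y (𝟙_ C)).inv ≫ E ⊴ᵣ t)
      (ExactPairing.coevaluation_evaluation X Y)
    simp only [actionHomRight_comp, actionHomRight_whiskerRight, whiskerRight_actionHomLeft,
      Category.assoc, Iso.inv_hom_id_assoc] at h
    rw [← cancel_mono ((αᵣ E (𝟙_ C) Y).hom ≫ (ρᵣ E).hom ⊵ᵣ Y)] at h
    have h₂ := action_exchange g (η_ X Y)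
    rw [← cancel_epi (ρᵣ D).inv, actionUnitIso_inv_naturality_assoc] at h₂
    simp only [comp_actionHomLeft]
    have h₃ : (αᵣ D X Y).hom ≫ (g ⊵ᵣ X) ⊵ᵣ Y = g ⊵ᵣ (X ⊗ Y) ≫ (αᵣ (E ⊙ᵣ Y) X Y).hom := by
      simp
    rw [reassoc_of% h₃, reassoc_of% h₂]
    refine Eq.trans (congrArg (g ≫ ·) ?_) (Category.comp_id g)
    have h₄ : (αᵣ (E ⊙ᵣ Y) X Y).hom ≫ (αᵣ E Y X).inv ⊵ᵣ Y =
        (αᵣ E Y (X ⊗ Y)).inv ≫ E ⊴ᵣ (α_ Y X Y).inv ≫ (αᵣ E (Y ⊗ X) Y).hom := by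
      have h₅ := actionHom_associator Y X Y E
      rw [← cancel_epi (E ⊴ᵣ (α_ Y X Y).inv), actionHomRight_inv_hom_assoc] at h₅
      rw [Iso.eq_inv_comp, reassoc_of% h₅, hom_inv_actionHomLeft, Category.comp_id]
    rw [reassoc_of% h₄]
    simp only [Category.assoc, Iso.inv_hom_id_assoc] at h
    rw [h, ← actionHom_leftUnitor, ← actionHomRight_comp, ← actionHomRight_comp]
    simp

lemma actionHomEquiv_apply (X Y : C) [ExactPairing X Y] {D E : M} (f : D ⊙ᵣ X ⟶ E) :
    actionHomEquiv X Y D E f =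
      (ρᵣ[C] D).inv ≫ D ⊴ᵣ η_ X Y ≫ (αᵣ D X Y).hom ≫ f ⊵ᵣ Y := rfl

lemma actionHomEquiv_naturality_left (X Y : C) [ExactPairing X Y] {D D' E : M} (f : D ⟶ D')
    (g : D' ⊙ᵣ X ⟶ E) :
    actionHomEquiv X Y D E (f ⊵ᵣ X ≫ g) = f ≫ actionHomEquiv X Y D' E g := by
  rw [actionHomEquiv_apply, actionHomEquiv_apply, ← actionUnitIso_inv_naturality_assoc,
    ← action_exchange_assoc, actionHomLeft_tensor]
  simp

lemma actionHomEquiv_naturality_right (X Y : C) [ExactPairing X Y] {D E E' : M}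
    (g : D ⊙ᵣ X ⟶ E) (f : E ⟶ E') :
    actionHomEquiv X Y D E' (g ≫ f) = actionHomEquiv X Y D E g ≫ f ⊵ᵣ Y := by
  rw [actionHomEquiv_apply, actionHomEquiv_apply, comp_actionHomLeft]
  simp only [Category.assoc]

/-- Compatibility of `actionHomEquiv` with morphisms of pairings `X ⟶ X'`, `Y' ⟶ Y`. -/
lemma actionHomEquiv_mate {X Y X' Y' : C} [ExactPairing X Y] [ExactPairing X' Y'] {D E : M}
    (h : X ⟶ X') (h' : Y' ⟶ Y) (hh : η_ X' Y' ≫ X' ◁ h' = η_ X Y ≫ h ▷ Y) (g : D ⊙ᵣ X' ⟶ E) :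
    actionHomEquiv X Y D E (D ⊴ᵣ h ≫ g) = actionHomEquiv X' Y' D E g ≫ E ⊴ᵣ h' := by
  rw [actionHomEquiv_apply, actionHomEquiv_apply]
  simp only [Category.assoc]
  rw [← action_exchange, comp_actionHomLeft]
  have h₁ := congrArg (fun t => D ⊴ᵣ t) hh
  simp only [actionHomRight_comp, whiskerRight_actionHomLeft, actionHomRight_whiskerRight] at h₁
  rw [← cancel_mono (αᵣ D X' Y).hom] at h₁
  simp only [Category.assoc, Iso.inv_hom_id, Category.comp_id] at h₁
  rw [← reassoc_of% h₁]

lemma actionAssoc_inv_aux (B : M) (W X Y : C) :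
    (αᵣ (B ⊙ᵣ W) X Y).hom ≫ (αᵣ B W X).inv ⊵ᵣ Y =
      (αᵣ B W (X ⊗ Y)).inv ≫ B ⊴ᵣ (α_ W X Y).inv ≫ (αᵣ B (W ⊗ X) Y).hom := by
  have h := actionHom_associator W X Y B
  rw [← cancel_epi (B ⊴ᵣ (α_ W X Y).inv), actionHomRight_inv_hom_assoc] at h
  rw [Iso.eq_inv_comp, reassoc_of% h, hom_inv_actionHomLeft, Category.comp_id]

lemma actionHomEquiv_tensor {X Y Z W : C} [ExactPairing X Y] (g : W ⊗ X ⟶ Z) (B : M) :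
    actionHomEquiv X Y (B ⊙ᵣ W) (B ⊙ᵣ Z) ((αᵣ B W X).inv ≫ B ⊴ᵣ g) =
      B ⊴ᵣ tensorRightHomEquiv W X Y Z g ≫ (αᵣ B Z Y).hom := by
  have h' := actionAssoc_inv_aux B W X Y
  rw [actionHomEquiv_apply, comp_actionHomLeft, reassoc_of% h']
  have h₃ : B ⊴ᵣ (ρ_ W).inv = (ρᵣ (B ⊙ᵣ W)).inv ≫ (αᵣ B W (𝟙_ C)).inv := by
    rw [← cancel_mono (B ⊴ᵣ (ρ_ W).hom), actionHomRight_inv_hom, actionHom_rightUnitor]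
    simp
  simp only [tensorRightHomEquiv, Equiv.coe_fn_mk, actionHomRight_comp, h₃,
    whiskerRight_actionHomLeft, actionHomRight_whiskerRight, Category.assoc,
    Iso.inv_hom_id_assoc, Iso.inv_hom_id, Category.comp_id]

end InternalHom

section DualHom

variable {C : Type u₁} [Category.{v₁} C] [MonoidalCategory C] [RigidCategory C]
  {M : Type u₂} [Category.{v₂} M] [MonoidalRightAction C M]

namespace InternalHom

variable {D B : M} (H : InternalHom C D B)

/-- The morphism `D ⟶ B ◁ Hom(D, B)ᘁ` corresponding to the evaluation `D ◁ Hom(D, B) ⟶ B`. -/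
def coact : D ⟶ B ⊙ᵣ rightDual H.obj := actionHomEquiv H.obj (rightDual H.obj) D B H.ev

/-- The morphism `Hom(D, B)ᘁ ⟶ Z` corresponding to `f : D ⟶ B ◁ Z`. -/
def coactDesc {Z : C} (f : D ⟶ B ⊙ᵣ Z) : rightDual H.obj ⟶ Z :=
  @rightAdjointMate C _ _ (leftDual Z) H.obj ⟨Z⟩ _
    (H.lift ((actionHomEquiv (leftDual Z) Z D B).symm f))

lemma coact_coactDesc {Z : C} (f : D ⟶ B ⊙ᵣ Z) : H.coact ≫ B ⊴ᵣ H.coactDesc f = f := by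
  rw [coact, ← actionHomEquiv_mate (X := leftDual Z) (Y := Z)
    (H.lift ((actionHomEquiv (leftDual Z) Z D B).symm f)) (H.coactDesc f), lift_ev,
    Equiv.apply_symm_apply]
  exact @coevaluation_comp_rightAdjointMate C _ _ (leftDual Z) H.obj ⟨Z⟩ _ _

lemma coact_hom_ext {Z : C} {g g' : rightDual H.obj ⟶ Z}
    (h : H.coact ≫ B ⊴ᵣ g = H.coact ≫ B ⊴ᵣ g') : g = g' := by
  have key (t : rightDual H.obj ⟶ Z) : η_ H.obj (rightDual H.obj) ≫ H.obj ◁ t =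
      η_ (leftDual Z) Z ≫ (@leftAdjointMate C _ _ (rightDual H.obj) Z ⟨H.obj⟩ _ t) ▷ Z :=
    (@coevaluation_comp_leftAdjointMate C _ _ (rightDual H.obj) Z ⟨H.obj⟩ _ t).symm
  rw [coact, ← actionHomEquiv_mate _ _ (key g), ← actionHomEquiv_mate _ _ (key g')] at h
  have h' := H.hom_ext ((actionHomEquiv _ _ _ _).injective h)
  have h₂ := (key g).trans ((congrArg (fun t => η_ (leftDual Z) Z ≫ t ▷ Z) h').trans
    (key g').symm)
  have h₃ := congrArg (tensorLeftHomEquiv (𝟙_ C) H.obj (rightDual H.obj) Z).symm h₂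
  rw [tensorLeftHomEquiv_symm_coevaluation_comp_whiskerLeft,
    tensorLeftHomEquiv_symm_coevaluation_comp_whiskerLeft] at h₃
  exact (cancel_epi _).1 h₃

/-- The bijection `Hom(Hom(D, B)ᘁ, Z) ≃ Hom(D, B ◁ Z)`. -/
def coactEquiv (Z : C) : (rightDual H.obj ⟶ Z) ≃ (D ⟶ B ⊙ᵣ Z) where
  toFun g := H.coact ≫ B ⊴ᵣ g
  invFun f := H.coactDesc f
  left_inv _ := H.coact_hom_ext (H.coact_coactDesc _)
  right_inv f := H.coact_coactDesc f

/-- Contravariant functoriality `Hom(D', B) ⟶ Hom(D, B)` along `f : D ⟶ D'`. -/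
def mapLeft {D D' : M} (H : InternalHom C D B) (H' : InternalHom C D' B) (f : D ⟶ D') :
    H'.obj ⟶ H.obj := H.lift (f ⊵ᵣ H'.obj ≫ H'.ev)

/-- Covariant functoriality `Hom(D, B) ⟶ Hom(D, B')` along `b : B ⟶ B'`. -/
def mapRight {B B' : M} (H : InternalHom C D B) (H' : InternalHom C D B') (b : B ⟶ B') :
    H.obj ⟶ H'.obj := H'.lift (H.ev ≫ b)

lemma coact_mapLeft {D D' : M} (H : InternalHom C D B) (H' : InternalHom C D' B) (f : D ⟶ D') :
    H.coact ≫ B ⊴ᵣ rightAdjointMate (H.mapLeft H' f) = f ≫ H'.coact := by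
  rw [coact, ← actionHomEquiv_mate _ _ (coevaluation_comp_rightAdjointMate (H.mapLeft H' f)),
    mapLeft, lift_ev, actionHomEquiv_naturality_left]
  rfl

lemma coact_mapRight {B B' : M} (H : InternalHom C D B) (H' : InternalHom C D B') (b : B ⟶ B') :
    H'.coact ≫ B' ⊴ᵣ rightAdjointMate (H.mapRight H' b) = H.coact ≫ b ⊵ᵣ rightDual H.obj := by
  rw [coact, ← actionHomEquiv_mate _ _ (coevaluation_comp_rightAdjointMate (H.mapRight H' b)),
    mapRight, lift_ev, actionHomEquiv_naturality_right]
  rfl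

/-- The module structure `Hom(D ◁ X, B)ᘁ ⟶ Hom(D, B)ᘁ ⊗ X`: the dual of the canonical
isomorphism `ᘁX ⊗ Hom(D, B) ≅ Hom(D ◁ X, B)`. It is the unique morphism through which
`D ◁ X ⟶ (B ◁ Hom(D, B)ᘁ) ◁ X ≅ B ◁ (Hom(D, B)ᘁ ⊗ X)` factors. -/
def coactTensor (H : InternalHom C D B) (X : C) (HX : InternalHom C (D ⊙ᵣ X) B) :
    rightDual HX.obj ⟶ rightDual H.obj ⊗ X :=
  HX.coactDesc (H.coact ⊵ᵣ X ≫ (αᵣ B (rightDual H.obj) X).inv)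

lemma coact_coactTensor (H : InternalHom C D B) (X : C) (HX : InternalHom C (D ⊙ᵣ X) B) :
    HX.coact ≫ B ⊴ᵣ coactTensor H X HX = H.coact ⊵ᵣ X ≫ (αᵣ B (rightDual H.obj) X).inv :=
  HX.coact_coactDesc _

lemma isIso_coactTensor (H : InternalHom C D B) (X : C) (HX : InternalHom C (D ⊙ᵣ X) B) :
    IsIso (coactTensor H X HX) := by
  rw [isIso_iff_coyoneda_map_bijective]
  intro Z
  let e : (rightDual H.obj ⊗ X ⟶ Z) ≃ (rightDual HX.obj ⟶ Z) :=
    (tensorRightHomEquiv (rightDual H.obj) X (rightDual X) Z).trans <|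
      (H.coactEquiv (Z ⊗ rightDual X)).trans <|
        (Iso.homToEquiv (αᵣ B Z (rightDual X))).trans <|
          (actionHomEquiv X (rightDual X) D (B ⊙ᵣ Z)).symm.trans (HX.coactEquiv Z).symm
  convert! e.bijective using 1
  ext g
  apply (HX.coactEquiv Z).injective
  apply (actionHomEquiv X (rightDual X) D (B ⊙ᵣ Z)).injective
  have h₁ : HX.coactEquiv Z (coactTensor H X HX ≫ g) =
      H.coact ⊵ᵣ X ≫ (αᵣ B (rightDual H.obj) X).inv ≫ B ⊴ᵣ g := by
    change HX.coact ≫ B ⊴ᵣ (coactTensor H X HX ≫ g) = _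
    rw [actionHomRight_comp, ← Category.assoc, coact_coactTensor, Category.assoc]
  rw [h₁, actionHomEquiv_naturality_left, actionHomEquiv_tensor]
  simp only [e, Equiv.trans_apply, Equiv.apply_symm_apply]
  change _ = (H.coact ≫ B ⊴ᵣ _) ≫ _
  rw [Category.assoc]

end InternalHom

section Phi

variable (I : ∀ D B : M, InternalHom C D B)

/-- The functor `Φ(B) : M ⥤ C`, `D ↦ Hom(D, B)ᘁ`. -/
def phiFunctor (B : M) : M ⥤ C where
  obj D := rightDual (I D B).obj
  map {D D'} f := rightAdjointMate ((I D B).mapLeft (I D' B) f)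
  map_id D := (I D B).coact_hom_ext (by
    rw [InternalHom.coact_mapLeft, Category.id_comp, actionHomRight_id, Category.comp_id])
  map_comp {D D' D''} f g := (I D B).coact_hom_ext (by
    rw [InternalHom.coact_mapLeft, actionHomRight_comp, ← Category.assoc,
      InternalHom.coact_mapLeft, Category.assoc, Category.assoc, InternalHom.coact_mapLeft])

/-- The universal morphism `D ⟶ B ◁ Φ(B)(D)`. -/
def phiCoact (B D : M) : D ⟶ B ⊙ᵣ (phiFunctor I B).obj D := (I D B).coact

lemma phi_hom_ext {B D : M} {Z : C} {g g' : (phiFunctor I B).obj D ⟶ Z}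
    (h : phiCoact I B D ≫ B ⊴ᵣ g = phiCoact I B D ≫ B ⊴ᵣ g') : g = g' :=
  (I D B).coact_hom_ext h

lemma phiCoact_naturality (B : M) {D D' : M} (f : D ⟶ D') :
    phiCoact I B D ≫ B ⊴ᵣ (phiFunctor I B).map f = f ≫ phiCoact I B D' :=
  InternalHom.coact_mapLeft _ _ _

/-- The bijection `Hom(Φ(B)(D), Z) ≃ Hom(D, B ◁ Z)`. -/
def phiEquiv (B D : M) (Z : C) :
    ((phiFunctor I B).obj D ⟶ Z) ≃ (D ⟶ (actionLeft C B).obj Z) :=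
  (I D B).coactEquiv Z

lemma phiEquiv_apply {B D : M} {Z : C} (g : (phiFunctor I B).obj D ⟶ Z) :
    phiEquiv I B D Z g = phiCoact I B D ≫ B ⊴ᵣ g := rfl

/-- `Φ(B)` is left adjoint to `B ◁ -`. -/
def phiAdjunction (B : M) : phiFunctor I B ⊣ actionLeft C B :=
  Adjunction.mkOfHomEquiv
    { homEquiv := phiEquiv I B
      homEquiv_naturality_left_symm := by
        intro D D' Z f g
        apply (phiEquiv I B D Z).injective
        rw [Equiv.apply_symm_apply, phiEquiv_apply, actionHomRight_comp, ← Category.assoc,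
          phiCoact_naturality, Category.assoc, ← phiEquiv_apply, Equiv.apply_symm_apply]
        rfl
      homEquiv_naturality_right := by
        intro D Z Z' f g
        rw [phiEquiv_apply, phiEquiv_apply, actionHomRight_comp, ← Category.assoc]
        rfl }

/-- The module structure `Φ(B)(D ◁ X) ⟶ Φ(B)(D) ⊗ X`. -/
def phiδ (B D : M) (X : C) :
    (phiFunctor I B).obj (D ⊙ᵣ X) ⟶ (phiFunctor I B).obj D ⊗ X :=
  InternalHom.coactTensor (I D B) X (I (D ⊙ᵣ X) B)

lemma phiCoact_phiδ (B D : M) (X : C) :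
    phiCoact I B (D ⊙ᵣ X) ≫ B ⊴ᵣ phiδ I B D X =
      phiCoact I B D ⊵ᵣ X ≫ (αᵣ B ((phiFunctor I B).obj D) X).inv :=
  InternalHom.coact_coactTensor _ _ _

lemma phiδ_naturality_right (B D : M) {X X' : C} (f : X ⟶ X') :
    (phiFunctor I B).map (D ⊴ᵣ f) ≫ phiδ I B D X' =
      phiδ I B D X ≫ (phiFunctor I B).obj D ◁ f := by
  apply phi_hom_ext
  rw [actionHomRight_comp, actionHomRight_comp, ← Category.assoc, ← Category.assoc,
    phiCoact_naturality, phiCoact_phiδ, Category.assoc, phiCoact_phiδ, ← Category.assoc,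
    action_exchange, whiskerRight_actionHomLeft]
  simp only [Category.assoc, Iso.inv_hom_id_assoc]

lemma phiδ_naturality_left (B : M) {D D' : M} (f : D ⟶ D') (X : C) :
    (phiFunctor I B).map (f ⊵ᵣ X) ≫ phiδ I B D' X =
      phiδ I B D X ≫ (phiFunctor I B).map f ▷ X := by
  apply phi_hom_ext
  rw [actionHomRight_comp, actionHomRight_comp, ← Category.assoc, ← Category.assoc,
    phiCoact_naturality, phiCoact_phiδ, Category.assoc, phiCoact_phiδ, ← Category.assoc,
    ← comp_actionHomLeft, ← phiCoact_naturality, actionHomRight_whiskerRight, comp_actionHomLeft]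
  simp only [Category.assoc, Iso.inv_hom_id_assoc]

lemma phiδ_associativity (B D : M) (X Y : C) :
    phiδ I B D (X ⊗ Y) ≫ (α_ ((phiFunctor I B).obj D) X Y).inv =
      (phiFunctor I B).map (αᵣ D X Y).hom ≫ phiδ I B (D ⊙ᵣ X) Y ≫ phiδ I B D X ▷ Y := by
  apply phi_hom_ext
  have h' : (αᵣ B ((phiFunctor I B).obj D) (X ⊗ Y)).inv ≫
      B ⊴ᵣ (α_ ((phiFunctor I B).obj D) X Y).inv =
      (αᵣ (B ⊙ᵣ (phiFunctor I B).obj D) X Y).hom ≫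
        (αᵣ B ((phiFunctor I B).obj D) X).inv ⊵ᵣ Y ≫
          (αᵣ B ((phiFunctor I B).obj D ⊗ X) Y).inv := by
    rw [← Category.assoc, actionAssoc_inv_aux, Category.assoc, Category.assoc, Iso.hom_inv_id,
      Category.comp_id]
  simp only [actionHomRight_comp]
  rw [← Category.assoc, phiCoact_phiδ, ← Category.assoc, phiCoact_naturality, Category.assoc,
    Category.assoc, ← Category.assoc (phiCoact I B ((D ⊙ᵣ X) ⊙ᵣ Y)), phiCoact_phiδ, h',
    actionHomRight_whiskerRight, actionHomLeft_tensor]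
  simp only [Category.assoc, Iso.inv_hom_id_assoc]
  have h := congrArg (fun t => t ⊵ᵣ Y) (phiCoact_phiδ I B D X)
  simp only [comp_actionHomLeft] at h
  rw [reassoc_of% h]

lemma phiδ_unitality (B D : M) :
    (ρ_ ((phiFunctor I B).obj D)).inv =
      (phiFunctor I B).map (ρᵣ[C] D).inv ≫ phiδ I B D (𝟙_ C) := by
  apply phi_hom_ext
  have h : B ⊴ᵣ (ρ_ ((phiFunctor I B).obj D)).inv =
      (ρᵣ (B ⊙ᵣ (phiFunctor I B).obj D)).inv ≫
        (αᵣ B ((phiFunctor I B).obj D) (𝟙_ C)).inv := by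
    rw [← cancel_mono (B ⊴ᵣ (ρ_ ((phiFunctor I B).obj D)).hom), actionHomRight_inv_hom,
      actionHom_rightUnitor]
    simp
  rw [actionHomRight_comp, ← Category.assoc, phiCoact_naturality, Category.assoc, phiCoact_phiδ,
    ← Category.assoc, actionUnitIso_inv_naturality, h, Category.assoc]

instance phiOplaxRightLinear (B : M) : (phiFunctor I B).OplaxRightLinear C where
  δᵣ D X := phiδ I B D X
  δᵣ_naturality_right D _ _ f := phiδ_naturality_right I B D f
  δᵣ_naturality_left f X := phiδ_naturality_left I B f X
  δᵣ_associativity D X Y := phiδ_associativity I B D X Y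
  δᵣ_unitality_inv D := phiδ_unitality I B D

noncomputable instance phiRightLinear (B : M) : (phiFunctor I B).RightLinear C :=
  rightLinearOfIsIso (phiFunctor I B) fun D X =>
    InternalHom.isIso_coactTensor (I D B) X (I (D ⊙ᵣ X) B)

/-- The dual `Hom(D, B')ᘁ ⟶ Hom(D, B)ᘁ` of the morphism induced by `b : B ⟶ B'`. -/
def phiMapApp {B B' : M} (b : B ⟶ B') (D : M) :
    (phiFunctor I B').obj D ⟶ (phiFunctor I B).obj D :=
  rightAdjointMate ((I D B).mapRight (I D B') b)

lemma phiCoact_phiMapApp {B B' : M} (b : B ⟶ B') (D : M) :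
    phiCoact I B' D ≫ B' ⊴ᵣ phiMapApp I b D =
      phiCoact I B D ≫ b ⊵ᵣ (phiFunctor I B).obj D :=
  InternalHom.coact_mapRight _ _ _

/-- Functoriality of `Φ(B)` in `B`: the duals of `Hom(D, B) ⟶ Hom(D, B')`. -/
def phiMap {B B' : M} (b : B ⟶ B') : phiFunctor I B' ⟶ phiFunctor I B where
  app D := phiMapApp I b D
  naturality D D' f := by
    apply phi_hom_ext
    rw [actionHomRight_comp, actionHomRight_comp, ← Category.assoc, phiCoact_naturality,
      Category.assoc, phiCoact_phiMapApp, ← Category.assoc (phiCoact I B' D),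
      phiCoact_phiMapApp, Category.assoc, ← action_exchange, ← Category.assoc (phiCoact I B D),
      phiCoact_naturality, Category.assoc]

lemma phiMapApp_phiδ {B B' : M} (b : B ⟶ B') (D : M) (X : C) :
    phiMapApp I b (D ⊙ᵣ X) ≫ phiδ I B D X = phiδ I B' D X ≫ phiMapApp I b D ▷ X := by
  apply phi_hom_ext
  have h := congrArg (fun t => t ⊵ᵣ X) (phiCoact_phiMapApp I b D)
  simp only [comp_actionHomLeft] at h
  rw [actionHomRight_comp, actionHomRight_comp, ← Category.assoc, phiCoact_phiMapApp,
    Category.assoc, ← action_exchange, ← Category.assoc, phiCoact_phiδ, ← Category.assoc,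
    phiCoact_phiδ, actionHomRight_whiskerRight]
  simp only [Category.assoc, Iso.inv_hom_id_assoc]
  rw [reassoc_of% h, actionHomLeft_tensor]
  simp only [Iso.inv_hom_id_assoc]

lemma phiMapApp_id (B D : M) : phiMapApp I (𝟙 B) D = 𝟙 _ := by
  apply phi_hom_ext
  rw [phiCoact_phiMapApp, id_actionHomLeft, actionHomRight_id]

lemma phiMapApp_comp {B B' B'' : M} (b : B ⟶ B') (b' : B' ⟶ B'') (D : M) :
    phiMapApp I (b ≫ b') D = phiMapApp I b' D ≫ phiMapApp I b D := by
  apply phi_hom_ext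
  rw [phiCoact_phiMapApp, actionHomRight_comp, ← Category.assoc, phiCoact_phiMapApp,
    Category.assoc, ← action_exchange, ← Category.assoc, phiCoact_phiMapApp, comp_actionHomLeft,
    Category.assoc]

end Phi

end DualHom

section PhiRex

variable (k : Type w) [Field k] {C : Type u₁} [Category.{v₁} C] [Abelian C] [Linear k C]
  [MonoidalCategory C] [RigidCategory C]
  {M : Type u₂} [Category.{v₂} M] [Abelian M] [Linear k M] [MonoidalRightAction C M]
  [IsFiniteModuleCategory k C M] (I : ∀ D B : M, InternalHom C D B)

lemma phiFunctor_additive (B : M) (hB : (actionLeft C B).Additive) :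
    (phiFunctor I B).Additive where
  map_add {D D' f g} := by
    apply phi_hom_ext
    refine (phiCoact_naturality I B (f + g)).trans ?_
    have h : B ⊴ᵣ ((phiFunctor I B).map f + (phiFunctor I B).map g) =
        B ⊴ᵣ (phiFunctor I B).map f + B ⊴ᵣ (phiFunctor I B).map g :=
      (actionLeft C B).map_add
    rw [h, Preadditive.comp_add, Preadditive.add_comp, phiCoact_naturality, phiCoact_naturality]

lemma phiFunctor_linear (B : M) : (phiFunctor I B).Linear k where
  map_smul {D D'} f r := by
    apply phi_hom_ext
    refine (phiCoact_naturality I B (r • f)).trans ?_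
    have h : B ⊴ᵣ (r • (phiFunctor I B).map f) = r • B ⊴ᵣ (phiFunctor I B).map f :=
      (actionLeft C B).map_smul r _
    rw [h, Linear.comp_smul, Linear.smul_comp, phiCoact_naturality]

/-- The right exact module functor `Φ(B) = Hom(-, B)ᘁ`. -/
noncomputable def phiObj (B : M) : RexModuleFunctor k C M C :=
  { functor := phiFunctor I B
    rightLinear := phiRightLinear I B
    additive := phiFunctor_additive I B
      (IsFiniteModuleCategory.additive_actionLeft (k := k) (C := C) B)
    linear := phiFunctor_linear k I B
    rightExact := ⟨fun _ _ _ =>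
      haveI := (phiAdjunction I B).leftAdjoint_preservesColimits
      inferInstance⟩ }

/-- The functor `Φ : Mᵒᵖ ⥤ Rex_C(M, C)`, `Φ(B)(D) = Hom(D, B)ᘁ`, for a choice `I` of internal
Homs. -/
noncomputable def phi : Mᵒᵖ ⥤ RexModuleFunctor k C M C where
  obj B := phiObj k I B.unop
  map b :=
    { natTrans := phiMap I b.unop
      comm := fun D X => phiMapApp_phiδ I b.unop D X }
  map_id B := RexModuleFunctor.hom_ext (fun D => phiMapApp_id I B.unop D)
  map_comp b b' := RexModuleFunctor.hom_ext (fun D => phiMapApp_comp I b'.unop b.unop D)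

end PhiRex

section CoendFunctor

variable {k : Type w} [Field k] {C : Type u₁} [Category.{v₁} C] [Preadditive C] [Linear k C]
  [MonoidalCategory C] [LeftRigidCategory C]
  {M : Type u₂} [Category.{v₂} M] [Preadditive M] [Linear k M] [MonoidalRightAction C M]

/-- The prebalancing of `(B, D) ↦ D ◁ ᘁF(B)`. -/
abbrev gammaPrebalancing (F : RexModuleFunctor k C M C) :
    Prebalancing C (dualBifunctor F.functor (𝟭 M)) :=
  dualPrebalancing F.functor (𝟭 M)

variable (c : ∀ F : RexModuleFunctor k C M C, RelativeCoend (gammaPrebalancing F))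

/-- The dinatural transformation `B ◁ ᘁF(B) ⟶ ∮ B ◁ ᘁF(B)`. -/
def coendι (F : RexModuleFunctor k C M C) (B : M) :
    B ⊙ᵣ leftDual (F.functor.obj B) ⟶ (c F).pt :=
  (c F).π B

/-- The family `B ◁ ᘁG(B) ⟶ B ◁ ᘁF(B) ⟶ ∮ B ◁ ᘁF(B)` induced by `θ : F ⟶ G`. -/
def coendMapFamily {F G : RexModuleFunctor k C M C} (θ : F ⟶ G) (B : M) :
    B ⊙ᵣ leftDual (G.functor.obj B) ⟶ (c F).pt :=
  B ⊴ᵣ leftAdjointMate (θ.natTrans.app B) ≫ coendι c F B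

lemma leftAdjointMate_natTrans_naturality {F G : RexModuleFunctor k C M C} (θ : F ⟶ G)
    {B B' : M} (f : B ⟶ B') :
    leftAdjointMate (G.functor.map f) ≫ leftAdjointMate (θ.natTrans.app B) =
      leftAdjointMate (θ.natTrans.app B') ≫ leftAdjointMate (F.functor.map f) := by
  rw [← comp_leftAdjointMate, ← comp_leftAdjointMate, θ.natTrans.naturality]

lemma leftAdjointMate_natTrans_dualModuleIso {F G : RexModuleFunctor k C M C} (θ : F ⟶ G)
    (B : M) (X : C) :
    leftAdjointMate (θ.natTrans.app (B ⊙ᵣ X)) ≫ (dualModuleIso F.functor B X).hom =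
      (dualModuleIso G.functor B X).hom ≫
        leftDual X ◁ leftAdjointMate (θ.natTrans.app B) := by
  have h₀ : (moduleIso F.functor B X).inv ≫ θ.natTrans.app (B ⊙ᵣ X) =
      θ.natTrans.app B ▷ X ≫ (moduleIso G.functor B X).inv := by
    rw [Iso.inv_comp_eq, ← Category.assoc, Iso.eq_comp_inv]
    exact θ.comm B X
  have h₁ : leftAdjointMate (θ.natTrans.app (B ⊙ᵣ X)) ≫
      leftAdjointMate (moduleIso F.functor B X).inv =
      leftAdjointMate (moduleIso G.functor B X).inv ≫
        leftAdjointMate (θ.natTrans.app B ⊗ₘ 𝟙 X) := by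
    rw [← comp_leftAdjointMate, ← comp_leftAdjointMate, MonoidalCategory.tensorHom_id, h₀]
  have h₂ := leftDualTensorIso_naturality (θ.natTrans.app B) (𝟙 X)
  rw [leftAdjointMate_id, MonoidalCategory.id_tensorHom] at h₂
  dsimp only [dualModuleIso, leftDualMapIso, Iso.trans_hom]
  rw [reassoc_of% h₁, h₂, Category.assoc]

lemma natTrans_gammaPrebalancing {F G : RexModuleFunctor k C M C} (θ : F ⟶ G) (X : C) (B D : M) :
    (dualPrebalancingIso G.functor (𝟭 M) X B D).hom ≫
        (D ⊙ᵣ leftDual X) ⊴ᵣ leftAdjointMate (θ.natTrans.app B) =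
      D ⊴ᵣ leftAdjointMate (θ.natTrans.app (B ⊙ᵣ X)) ≫
        (dualPrebalancingIso F.functor (𝟭 M) X B D).hom := by
  rw [dualPrebalancingIso_hom, dualPrebalancingIso_hom]
  change (D ⊴ᵣ _ ≫ _ ≫ 𝟙 (D ⊙ᵣ leftDual X) ⊵ᵣ _) ≫ _ =
    _ ≫ D ⊴ᵣ _ ≫ _ ≫ 𝟙 (D ⊙ᵣ leftDual X) ⊵ᵣ _
  rw [id_actionHomLeft, id_actionHomLeft, Category.comp_id, Category.comp_id,
    ← actionHomRight_comp_assoc, leftAdjointMate_natTrans_dualModuleIso, actionHomRight_comp,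
    whiskerRight_actionHomLeft]
  simp only [Functor.id_obj, Category.assoc, Iso.inv_hom_id, Category.comp_id]

lemma coendMapFamily_isDinatural {F G : RexModuleFunctor k C M C} (θ : F ⟶ G) :
    IsDinatural (dualBifunctor G.functor (𝟭 M)) (coendMapFamily c θ) := by
  intro B B' f
  have h : B ⊴ᵣ leftAdjointMate (F.functor.map f) ≫ coendι c F B =
      f ⊵ᵣ leftDual (F.functor.obj B') ≫ coendι c F B' := (c F).dinatural f
  change B ⊴ᵣ leftAdjointMate (G.functor.map f) ≫
      B ⊴ᵣ leftAdjointMate (θ.natTrans.app B) ≫ coendι c F B =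
    f ⊵ᵣ leftDual (G.functor.obj B') ≫
      B' ⊴ᵣ leftAdjointMate (θ.natTrans.app B') ≫ coendι c F B'
  rw [← actionHomRight_comp_assoc, leftAdjointMate_natTrans_naturality, actionHomRight_comp,
    Category.assoc, h, action_exchange_assoc]

lemma coendMapFamily_isBalanced {F G : RexModuleFunctor k C M C} (θ : F ⟶ G) :
    IsBalanced (gammaPrebalancing G) (coendMapFamily c θ) := by
  intro X B
  have h : B ⊴ᵣ leftAdjointMate (F.functor.map
        ((ρᵣ[C] B).inv ≫ B ⊴ᵣ η_ (leftDual X) X)) ≫ coendι c F B =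
      B ⊴ᵣ leftAdjointMate (F.functor.map (αᵣ B (leftDual X) X).inv) ≫
        (dualPrebalancingIso F.functor (𝟭 M) X (B ⊙ᵣ leftDual X) B).hom ≫
          coendι c F (B ⊙ᵣ leftDual X) := (c F).balanced X B
  change B ⊴ᵣ leftAdjointMate (G.functor.map
        ((ρᵣ[C] B).inv ≫ B ⊴ᵣ η_ (leftDual X) X)) ≫
        B ⊴ᵣ leftAdjointMate (θ.natTrans.app B) ≫ coendι c F B =
      B ⊴ᵣ leftAdjointMate (G.functor.map (αᵣ B (leftDual X) X).inv) ≫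
        (dualPrebalancingIso G.functor (𝟭 M) X (B ⊙ᵣ leftDual X) B).hom ≫
          (B ⊙ᵣ leftDual X) ⊴ᵣ leftAdjointMate (θ.natTrans.app (B ⊙ᵣ leftDual X)) ≫
            coendι c F (B ⊙ᵣ leftDual X)
  have h₁ := natTrans_gammaPrebalancing θ X (B ⊙ᵣ leftDual X) B
  rw [reassoc_of% h₁, ← actionHomRight_comp_assoc, ← actionHomRight_comp_assoc,
    leftAdjointMate_natTrans_naturality, leftAdjointMate_natTrans_naturality,
    actionHomRight_comp, actionHomRight_comp, Category.assoc, Category.assoc, h]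

/-- The morphism `∮ B ◁ ᘁG(B) ⟶ ∮ B ◁ ᘁF(B)` induced by `θ : F ⟶ G`. -/
def coendMap {F G : RexModuleFunctor k C M C} (θ : F ⟶ G) : (c G).pt ⟶ (c F).pt :=
  (c G).desc (coendMapFamily c θ) (coendMapFamily_isDinatural c θ)
    (coendMapFamily_isBalanced c θ)

lemma π_coendMap {F G : RexModuleFunctor k C M C} (θ : F ⟶ G) (B : M) :
    coendι c G B ≫ coendMap c θ = B ⊴ᵣ leftAdjointMate (θ.natTrans.app B) ≫ coendι c F B :=
  (c G).fac _ _ _ B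

/-- The functor `F ↦ ∮ B ◁ ᘁF(B)`, for a choice `c` of relative coends. -/
def coendFunctor : RexModuleFunctor k C M C ⥤ Mᵒᵖ where
  obj F := op (c F).pt
  map θ := (coendMap c θ).op
  map_id F := by
    refine congrArg Quiver.Hom.op ((c F).hom_ext fun B => ?_)
    change coendι c F B ≫ coendMap c (𝟙 F) = coendι c F B ≫ 𝟙 (c F).pt
    rw [π_coendMap, Category.comp_id, RexModuleFunctor.id_natTrans, NatTrans.id_app,
      leftAdjointMate_id, actionHomRight_id, Category.id_comp]
  map_comp {F G H} θ η := by
    refine congrArg Quiver.Hom.op ((c H).hom_ext fun B => ?_)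
    change coendι c H B ≫ coendMap c (θ ≫ η) = coendι c H B ≫ coendMap c η ≫ coendMap c θ
    rw [π_coendMap, RexModuleFunctor.comp_natTrans, NatTrans.comp_app, comp_leftAdjointMate,
      actionHomRight_comp, Category.assoc, ← Category.assoc (coendι c H B), π_coendMap, Category.assoc, π_coendMap]

end CoendFunctor

end RelCoend

/-!
The theorem rests on the following observation. Let `F : M ⥤ C` be a module functor such that the
presheaf `Hom(F(-), 𝟙)` is representable, by an object `B` with universal morphism `F(B) ⟶ 𝟙`.
Duality in `C` then makes `F` left adjoint to `B ◁ -`, because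
`Hom(F(D), Z) ≃ Hom(F(D) ⊗ ᘁZ, 𝟙) ≃ Hom(F(D ◁ ᘁZ), 𝟙) ≃ Hom(D ◁ ᘁZ, B) ≃ Hom(D, B ◁ Z)`.
Moreover, for every module functor `G : M ⥤ N`, the object `G(B)` is the relative coend of
`G(D) ◁ ᘁF(E)` (`reprCoend`). The coend family is `G` applied to the morphisms `D ◁ ᘁF(D) ⟶ B` that
represent the evaluations of `F(D)`, and a balanced dinatural family `ξ` induces
`G(B) ≅ G(B) ◁ 𝟙 ⟶ G(B) ◁ ᘁF(B) ⟶ T`, the last arrow being `ξ` at `B`. That this is a factorization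
uses the balancing condition in the form `IsBalanced.apply_action`, which expresses `ξ` at `D ◁ X`
through `ξ` at `D`. The cases `G = 𝟭` and `G = F'` give both existence statements for coends.

Representability comes from finiteness (`isRepresentable_of_rightExact`): for a right exact linear
functor `F` between finite categories, every `Hom(F(-), Z)` is representable. Call `x : F(X) ⟶ Z`
faithful if no nonzero morphism to `X` kills it. Every `x` comes from a faithful element on a
quotient of `X`, the dimension of `Hom(Q, X)` is bounded on faithful elements, where `Q` is the sum
of the projective covers of the simple objects, and a faithful element maximizing this dimension is
universal. Applied to `D ◁ -` this yields the internal Homs.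

For the equivalence, the adjunction `Φ(B) ⊣ B ◁ -` shows that `B` represents `Hom(Φ(B)(-), 𝟙)`, so
that the relative coend of `Φ(B)` is `B`. Conversely, for a relative coend `E` of `F`, the
morphisms `D ⟶ E ◁ F(D)` adjunct to the coend family (`coendUnit`) form a module transformation and
the unit of an adjunction `F ⊣ E ◁ -`; comparing it with `Φ(E) ⊣ E ◁ -` gives `Φ(E) ≅ F`.
-/

namespace RelCoend

/-! ### Representability of left exact presheaves on finite categories -/

section Representability

open ZeroObject

variable {A : Type u₁} [Category.{v₁} A] [Abelian A] {A' : Type u₂} [Category.{v₂} A'] [Abelian A']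

/-- A projective object of a finite category that admits a nonzero morphism to every nonzero
object: the direct sum of projective covers of representatives of the simple objects. -/
lemma exists_projective_detecting_zero (k : Type w) [Field k] [Linear k A]
    [IsFiniteLinearCategory k A] :
    ∃ Q : A, Projective Q ∧ ∀ W : A, (∀ f : Q ⟶ W, f = 0) → IsZero W := by
  obtain ⟨n, S, hS⟩ := IsFiniteLinearCategory.finite_simples (k := k) (A := A)
  have h (i : Fin n) : ∃ Q : A, Projective Q ∧ (Simple (S i) → ∃ p : Q ⟶ S i, p ≠ 0) := by
    by_cases hi : Simple (S i)
    · obtain ⟨P, p, hP, hp, -⟩ := IsFiniteLinearCategory.projective_cover (k := k) (S i) hi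
      refine ⟨P, hP, fun _ => ⟨p, fun h0 => ?_⟩⟩
      subst h0
      exact Simple.not_isZero (S i) ((IsZero.iff_id_eq_zero _).2
        ((cancel_epi (0 : P ⟶ S i)).1 (by simp)))
    · exact ⟨0, inferInstance, fun h => absurd h hi⟩
  choose Q hQ hQS using h
  have := Abelian.hasFiniteBiproducts (C := A)
  refine ⟨⨁ Q, ⟨fun f e _ => ⟨biproduct.desc fun i =>
    Projective.factorThru (biproduct.ι Q i ≫ f) e, by ext i; simp⟩⟩, fun W hW => ?_⟩
  by_contra hW0
  have := IsFiniteLinearCategory.artinian (k := k) W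
  obtain ⟨i, ⟨e⟩⟩ := hS (simpleSubobject hW0) inferInstance
  have : Simple (S i) := Simple.of_iso e.symm
  obtain ⟨p, hp⟩ := hQS i this
  have h1 := hW (biproduct.π Q i ≫ p ≫ e.inv ≫ simpleSubobjectArrow hW0)
  apply hp
  rw [← cancel_epi (biproduct.π Q i), ← cancel_mono (e.inv ≫ simpleSubobjectArrow hW0)]
  simpa using h1

/-- An element `x : F X ⟶ Z` is faithful if no nonzero morphism to `X` annihilates it, i.e. if
the induced map `Hom(-, X) ⟶ Hom(F(-), Z)` is injective. -/
def IsFaithfulElement (F : A ⥤ A') {X : A} {Z : A'} (x : F.obj X ⟶ Z) : Prop :=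
  ∀ ⦃W : A⦄ (g : W ⟶ X), F.map g ≫ x = 0 → g = 0

/-- Every morphism `x : F X ⟶ Z` comes from a faithful element on a quotient of `X`. -/
lemma exists_isFaithfulElement (F : A ⥤ A') [F.Additive] [PreservesFiniteColimits F] {X : A}
    [IsNoetherianObject X] {Z : A'} (x : F.obj X ⟶ Z) :
    ∃ (Y : A) (q : X ⟶ Y) (y : F.obj Y ⟶ Z), F.map q ≫ y = x ∧ IsFaithfulElement F y := by
  -- `K` is a maximal subobject of `X` annihilated by `x`; the quotient is `X / K`
  obtain ⟨K, hK, hmax⟩ := WellFounded.has_min (wellFounded_gt (α := Subobject X))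
    {K | F.map K.arrow ≫ x = 0} ⟨⊥, by
      show F.map (Subobject.arrow ⊥) ≫ x = 0
      rw [Subobject.bot_arrow, F.map_zero, zero_comp]⟩
  let hc := isColimitOfHasCokernelOfPreservesColimit F K.arrow
  let y : F.obj (cokernel K.arrow) ⟶ Z := hc.desc (CokernelCofork.ofπ x hK)
  have hy : F.map (cokernel.π K.arrow) ≫ y = x := hc.fac (CokernelCofork.ofπ x hK) .one
  refine ⟨_, cokernel.π K.arrow, y, hy, fun W g hg => ?_⟩
  -- if `y` annihilates `g`, then `x` annihilates the preimage in `X` of the image of `g`; as this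
  -- preimage contains `K`, it equals `K` by maximality
  let a := pullback.fst (cokernel.π K.arrow) g
  have ha : F.map a ≫ x = 0 := by
    rw [← hy, ← F.map_comp_assoc, pullback.condition, F.map_comp, Category.assoc, hg, comp_zero]
  have hI : F.map (imageSubobject a).arrow ≫ x = 0 := by
    rw [← cancel_epi (F.map (factorThruImageSubobject a)), ← F.map_comp_assoc,
      imageSubobject_arrow_comp, ha, comp_zero]
  have hle : K ≤ imageSubobject a := by
    have : K.arrow = pullback.lift K.arrow 0 (by simp) ≫ a := (pullback.lift_fst _ _ _).symm
    refine Subobject.le_of_comm (pullback.lift K.arrow 0 (by simp) ≫ factorThruImageSubobject a) ?_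
    rw [Category.assoc, imageSubobject_arrow_comp, ← this]
  have hKI : K = imageSubobject a := by
    by_contra hne
    exact hmax _ hI (lt_of_le_of_ne hle hne)
  rw [← cancel_epi (pullback.snd (cokernel.π K.arrow) g), ← pullback.condition, comp_zero]
  have : a = factorThruImageSubobject a ≫ (imageSubobject a).arrow := by simp
  change a ≫ _ = 0
  rw [this, Category.assoc]
  have h2 : (imageSubobject a).arrow ≫ cokernel.π K.arrow = 0 := by
    rw [← hKI]
    simp
  rw [h2, comp_zero]

/-- For a right exact linear functor `F` between finite categories, `Hom(F(-), Z)` is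
representable. A faithful element on an object `X` of maximal `dim Hom(Q, X)`, with `Q` as in
`exists_projective_detecting_zero`, is universal: joining it with another element gives a faithful
element on a larger object, which cannot be strictly larger. -/
theorem isRepresentable_of_rightExact (k : Type w) [Field k] [Linear k A] [Linear k A']
    [IsFiniteLinearCategory k A] [IsFiniteLinearCategory k A'] (F : A ⥤ A') [F.Additive]
    [F.Linear k] [PreservesFiniteColimits F] (Z : A') :
    (F.op ⋙ yoneda.obj Z).IsRepresentable := by
  obtain ⟨Q, hQ, hQ0⟩ := exists_projective_detecting_zero (A := A) k
  have := IsFiniteLinearCategory.finite_hom (k := k) (A := A)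
  have := IsFiniteLinearCategory.finite_hom (k := k) (A := A')
  have := IsFiniteLinearCategory.noetherian (k := k) (A := A)
  -- faithfulness bounds `dim Hom(Q, X)` by `dim Hom(F Q, Z)`
  have hbound {X : A} (x : F.obj X ⟶ Z) (hx : IsFaithfulElement F x) :
      Module.finrank k (Q ⟶ X) ≤ Module.finrank k (F.obj Q ⟶ Z) := by
    let l : (Q ⟶ X) →ₗ[k] (F.obj Q ⟶ Z) := (Linear.rightComp k _ x).comp (F.mapLinearMap k)
    refine LinearMap.finrank_le_finrank_of_injective (f := l) ?_
    rw [injective_iff_map_eq_zero]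
    exact fun g hg => hx g hg
  let s : Set ℕ := {m | ∃ (X : A) (x : F.obj X ⟶ Z), IsFaithfulElement F x ∧
    Module.finrank k (Q ⟶ X) = m}
  have hne : s.Nonempty := by
    obtain ⟨Y, -, y, -, hy⟩ := exists_isFaithfulElement F (0 : F.obj (0 : A) ⟶ Z)
    exact ⟨_, Y, y, hy, rfl⟩
  have hbdd : BddAbove s := ⟨Module.finrank k (F.obj Q ⟶ Z), by
    rintro _ ⟨X, x, hx, rfl⟩
    exact hbound x hx⟩
  obtain ⟨X, x, hx, hX⟩ := Nat.sSup_mem hne hbdd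
  have hmax {X' : A} (x' : F.obj X' ⟶ Z) (hx' : IsFaithfulElement F x') :
      Module.finrank k (Q ⟶ X') ≤ Module.finrank k (Q ⟶ X) := by
    rw [hX]
    exact le_csSup hbdd ⟨X', x', hx', rfl⟩
  have hbij (Y : A) : Function.Bijective (fun g : Y ⟶ X => F.map g ≫ x) := by
    constructor
    · intro g g' h
      rw [← sub_eq_zero]
      apply hx
      rw [F.map_sub, Preadditive.sub_comp, sub_eq_zero]
      exact h
    · intro y
      obtain ⟨W, q, z, hz, hzf⟩ := exists_isFaithfulElement F
        (F.map (biprod.fst : X ⊞ Y ⟶ X) ≫ x + F.map (biprod.snd : X ⊞ Y ⟶ Y) ≫ y)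
      -- `i` is a monomorphism because `x` is faithful, and it is surjective on `Hom(Q, -)` by
      -- maximality, so that its cokernel vanishes
      let i : X ⟶ W := biprod.inl ≫ q
      let j : Y ⟶ W := biprod.inr ≫ q
      have hi : F.map i ≫ z = x := by
        rw [F.map_comp, Category.assoc, hz, Preadditive.comp_add, ← F.map_comp_assoc,
          ← F.map_comp_assoc]
        simp
      have hj : F.map j ≫ z = y := by
        rw [F.map_comp, Category.assoc, hz, Preadditive.comp_add, ← F.map_comp_assoc,
          ← F.map_comp_assoc]
        simp
      have hmono : Mono i := by
        refine Preadditive.mono_of_cancel_zero _ fun {V} g hg => hx g ?_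
        rw [← hi, ← F.map_comp_assoc, hg, F.map_zero, zero_comp]
      have hsurj : Function.Surjective (Linear.rightComp k Q i) := by
        rw [← LinearMap.injective_iff_surjective_of_finrank_eq_finrank]
        · exact fun g g' h => (cancel_mono i).1 h
        · refine le_antisymm (LinearMap.finrank_le_finrank_of_injective
            (f := Linear.rightComp k Q i) fun g g' h => (cancel_mono i).1 h) (hmax z hzf)
      have hcok : IsZero (cokernel i) := hQ0 _ fun f => by
        obtain ⟨g, hg⟩ := hsurj (Projective.factorThru f (cokernel.π i))
        rw [← Projective.factorThru_comp f (cokernel.π i), ← hg]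
        simp
      have : Epi i := Preadditive.epi_of_isZero_cokernel i hcok
      have : IsIso i := isIso_of_mono_of_epi i
      refine ⟨j ≫ inv i, ?_⟩
      change F.map (j ≫ inv i) ≫ x = y
      rw [← hi, ← F.map_comp_assoc, Category.assoc, IsIso.inv_hom_id, Category.comp_id, hj]
  exact ⟨X, ⟨{
    homEquiv := fun {Y} => Equiv.ofBijective _ (hbij Y)
    homEquiv_comp := fun f g => by
      change F.map (f ≫ g) ≫ x = F.map f ≫ F.map g ≫ x
      rw [F.map_comp, Category.assoc] }⟩⟩

end Representability

/-! ### Adjunctions between actions of dual objects -/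

section ActionCalculus

variable {C : Type u₁} [Category.{v₁} C] [MonoidalCategory C]
  {M : Type u₂} [Category.{v₂} M] [MonoidalRightAction C M]

/-- The adjunction bijection of a tensor product of exact pairings is the composite of the
bijections of the two factors. -/
lemma actionHomEquiv_tensorPairing (X₁ Y₁ X₂ Y₂ : C) [ExactPairing X₁ Y₁] [ExactPairing X₂ Y₂]
    {D E : M} (f : D ⊙ᵣ (X₁ ⊗ X₂) ⟶ E) :
    actionHomEquiv (X₁ ⊗ X₂) (Y₂ ⊗ Y₁) D E f =
      actionHomEquiv X₁ Y₁ D (E ⊙ᵣ Y₂)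
        (actionHomEquiv X₂ Y₂ (D ⊙ᵣ X₁) E ((αᵣ D X₁ X₂).inv ≫ f)) ≫ (αᵣ E Y₂ Y₁).inv := by
  have hη : η_ (X₁ ⊗ X₂) (Y₂ ⊗ Y₁) = η_ X₁ Y₁ ≫ (ρ_ X₁).inv ▷ Y₁ ≫ (X₁ ◁ η_ X₂ Y₂) ▷ Y₁ ≫
      (α_ X₁ X₂ Y₂).inv ▷ Y₁ ≫ (α_ (X₁ ⊗ X₂) Y₂ Y₁).hom := by
    rw [ExactPairing.tensor_coevaluation]
    monoidal
  have h₁ := actionAssoc_inv_aux D X₁ X₂ Y₂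
  have h₂ := actionHom_associator (X₁ ⊗ X₂) Y₂ Y₁ D
  have h₃ : D ⊴ᵣ (ρ_ X₁).inv = (ρᵣ (D ⊙ᵣ X₁)).inv ≫ (αᵣ D X₁ (𝟙_ C)).inv := by
    rw [← cancel_mono (D ⊴ᵣ (ρ_ X₁).hom), actionHomRight_inv_hom, actionHom_rightUnitor]
    simp
  have h₄ : (αᵣ D (X₁ ⊗ X₂) (Y₂ ⊗ Y₁)).hom ≫ f ⊵ᵣ (Y₂ ⊗ Y₁) = D ⊴ᵣ (α_ (X₁ ⊗ X₂) Y₂ Y₁).inv ≫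
      (αᵣ D ((X₁ ⊗ X₂) ⊗ Y₂) Y₁).hom ≫ ((αᵣ D (X₁ ⊗ X₂) Y₂).hom ≫ f ⊵ᵣ Y₂) ⊵ᵣ Y₁ ≫
        (αᵣ E Y₂ Y₁).inv := by
    rw [← cancel_epi (D ⊴ᵣ (α_ (X₁ ⊗ X₂) Y₂ Y₁).hom), actionHomRight_hom_inv_assoc,
      comp_actionHomLeft, actionHomLeft_tensor, reassoc_of% h₂]
    simp only [Category.assoc]
  rw [actionHomEquiv_apply, actionHomEquiv_apply, actionHomEquiv_apply, h₄, hη]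
  simp only [actionHomRight_comp, Category.assoc, actionHomRight_hom_inv_assoc]
  simp only [actionHomRight_whiskerRight, Category.assoc, Iso.inv_hom_id_assoc]
  simp only [← comp_actionHomLeft_assoc]
  congr 5
  rw [h₃, comp_actionHomLeft, reassoc_of% h₁, whiskerRight_actionHomLeft]
  simp only [Category.assoc, Iso.inv_hom_id_assoc]

open Functor.OplaxRightLinear Functor.LaxRightLinear in
lemma map_actionAssocIso_hom_δᵣ {N : Type u₃} [Category.{v₃} N] [MonoidalRightAction C N]
    (G : M ⥤ N) [G.RightLinear C] (D : M) (X Y : C) :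
    G.map (αᵣ D X Y).hom ≫ δᵣ G (D ⊙ᵣ X) Y =
      δᵣ G D (X ⊗ Y) ≫ (αᵣ (G.obj D) X Y).hom ≫ μᵣ G D X ⊵ᵣ Y := by
  rw [δᵣ_associativity_assoc, ← comp_actionHomLeft, Functor.RightLinear.δᵣ_comp_μᵣ,
    id_actionHomLeft, Category.comp_id]

end ActionCalculus

/-! ### Duals of the values of a module functor -/

section Duals

variable {C : Type u₁} [Category.{v₁} C] [MonoidalCategory C] [LeftRigidCategory C]
  {M : Type u₂} [Category.{v₂} M] [MonoidalRightAction C M]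

open Functor.OplaxRightLinear Functor.LaxRightLinear

/-- The inverse of `dualModuleIso` is the dual of `δᵣ`, with `ᘁX ⊗ ᘁF(B)` as the dual of
`F(B) ⊗ X`. -/
lemma dualModuleIso_inv (F : M ⥤ C) [F.RightLinear C] (B : M) (X : C) :
    (dualModuleIso F B X).inv =
      @leftAdjointMate C _ _ (F.obj (B ⊙ᵣ X)) (F.obj B ⊗ X) _ hasLeftDualTensor (δᵣ F B X) := by
  refine (@comp_leftAdjointMate C _ _ (F.obj (B ⊙ᵣ X)) (F.obj B ⊗ X) (F.obj B ⊗ X) _ _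
    hasLeftDualTensor (δᵣ F B X) (𝟙 _)).symm.trans ?_
  rw [Category.comp_id]

/-- The evaluation of `F(B ◁ X)` in terms of the evaluations of `F(B)` and `X`. -/
lemma dualModuleIso_inv_evaluation (F : M ⥤ C) [F.RightLinear C] (B : M) (X : C) :
    F.obj (B ⊙ᵣ X) ◁ (dualModuleIso F B X).inv ≫
        ε_ (leftDual (F.obj (B ⊙ᵣ X))) (F.obj (B ⊙ᵣ X)) =
      δᵣ F B X ▷ (leftDual X ⊗ leftDual (F.obj B)) ≫
        ε_ (leftDual X ⊗ leftDual (F.obj B)) (F.obj B ⊗ X) := by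
  rw [dualModuleIso_inv]
  exact @leftAdjointMate_comp_evaluation C _ _ (F.obj (B ⊙ᵣ X)) (F.obj B ⊗ X) _
    hasLeftDualTensor (δᵣ F B X)

lemma coevaluation_dualModuleIso_inv (F : M ⥤ C) [F.RightLinear C] (B : M) (X : C) :
    η_ (leftDual X ⊗ leftDual (F.obj B)) (F.obj B ⊗ X) ≫
        (dualModuleIso F B X).inv ▷ (F.obj B ⊗ X) =
      η_ (leftDual (F.obj (B ⊙ᵣ X))) (F.obj (B ⊙ᵣ X)) ≫
        leftDual (F.obj (B ⊙ᵣ X)) ◁ δᵣ F B X := by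
  rw [dualModuleIso_inv]
  exact @coevaluation_comp_leftAdjointMate C _ _ (F.obj (B ⊙ᵣ X)) (F.obj B ⊗ X) _
    hasLeftDualTensor (δᵣ F B X)

/-- The morphism `𝟙 ⟶ ᘁP` dual to `f : P ⟶ 𝟙`. -/
def coname {P : C} (f : P ⟶ 𝟙_ C) : 𝟙_ C ⟶ leftDual P :=
  η_ (leftDual P) P ≫ leftDual P ◁ f ≫ (ρ_ _).hom

lemma whiskerLeft_coname_evaluation {P : C} (f : P ⟶ 𝟙_ C) :
    P ◁ coname f ≫ ε_ (leftDual P) P = (ρ_ P).hom ≫ f := by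
  calc _ = P ◁ η_ (leftDual P) P ⊗≫ ((P ⊗ leftDual P) ◁ f ≫ ε_ (leftDual P) P ▷ 𝟙_ C) ⊗≫ 𝟙 _ := by
        rw [coname]; monoidal
    _ = (P ◁ η_ (leftDual P) P ⊗≫ ε_ (leftDual P) P ▷ P) ⊗≫ f := by
        rw [whisker_exchange]; monoidal
    _ = _ := by rw [ExactPairing.coevaluation_evaluation'']; monoidal

lemma coname_comp {P P' : C} (p : P' ⟶ P) (f : P ⟶ 𝟙_ C) :
    coname f ≫ leftAdjointMate p = coname (p ≫ f) := by
  apply leftDual_hom_ext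
  rw [MonoidalCategory.whiskerLeft_comp, Category.assoc, leftAdjointMate_comp_evaluation,
    whisker_exchange_assoc, whiskerLeft_coname_evaluation, whiskerLeft_coname_evaluation]
  simp

/-- The dual of the evaluation `F(D ◁ ᘁF(D)) ≅ F(D) ⊗ ᘁF(D) ⟶ 𝟙` is the coevaluation of
`ᘁF(D)`. -/
lemma coname_evaluation (F : M ⥤ C) [F.RightLinear C] (D : M) :
    coname ((δᵣ F D (leftDual (F.obj D)) ≫ ε_ (leftDual (F.obj D)) (F.obj D) :
        F.obj (D ⊙ᵣ leftDual (F.obj D)) ⟶ 𝟙_ C)) =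
      η_ (leftDual (leftDual (F.obj D))) (leftDual (F.obj D)) ≫
        (dualModuleIso F D (leftDual (F.obj D))).inv := by
  apply leftDual_hom_ext
  rw [whiskerLeft_coname_evaluation, MonoidalCategory.whiskerLeft_comp, Category.assoc,
    dualModuleIso_inv_evaluation, whisker_exchange_assoc, ExactPairing.tensor_evaluation]
  generalize (δᵣ F D (leftDual (F.obj D))) = d
  change F.obj (D ⊙ᵣ leftDual (F.obj D)) ⟶ F.obj D ⊗ leftDual (F.obj D) at d
  symm
  calc _ = d ▷ 𝟙_ C ⊗≫ F.obj D ◁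
        (leftDual (F.obj D) ◁ η_ (leftDual (leftDual (F.obj D))) (leftDual (F.obj D)) ⊗≫
          ε_ (leftDual (leftDual (F.obj D))) (leftDual (F.obj D)) ▷ leftDual (F.obj D)) ⊗≫
        ε_ (leftDual (F.obj D)) (F.obj D) := by monoidal
    _ = _ := by rw [ExactPairing.coevaluation_evaluation'']; monoidal

/-- The two ways of contracting `F(D)` with `ᘁF(D ◁ (ᘁX ⊗ X))`, through the coevaluation of `X` or
through the dual of the module structure of `F`, agree. This is the balancing condition for the
family `reprπ`, composed with the universal morphism `F(B) ⟶ 𝟙` after applying `F`. -/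
lemma map_coev_evaluation (F : M ⥤ C) [F.RightLinear C] (D : M) (X : C) :
    F.map ((ρᵣ[C] D).inv ≫ D ⊴ᵣ η_ (leftDual X) X) ▷ leftDual (F.obj (D ⊙ᵣ (leftDual X ⊗ X))) ≫
        ε_ _ (F.obj (D ⊙ᵣ (leftDual X ⊗ X))) =
      F.obj D ◁ leftAdjointMate (F.map (αᵣ D (leftDual X) X).inv) ≫
        F.obj D ◁ (dualModuleIso F (D ⊙ᵣ leftDual X) X).hom ≫
          (α_ (F.obj D) (leftDual X) (leftDual (F.obj (D ⊙ᵣ leftDual X)))).inv ≫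
            μᵣ F D (leftDual X) ▷ leftDual (F.obj (D ⊙ᵣ leftDual X)) ≫ ε_ _ _ := by
  have hα : leftAdjointMate (F.map (αᵣ D (leftDual X) X).hom) ≫
      leftAdjointMate (F.map (αᵣ D (leftDual X) X).inv) = 𝟙 _ := by
    rw [← comp_leftAdjointMate, ← F.map_comp, Iso.inv_hom_id, F.map_id, leftAdjointMate_id]
  have hα' : IsIso (leftAdjointMate (F.map (αᵣ D (leftDual X) X).hom)) :=
    ⟨_, hα, by rw [← comp_leftAdjointMate, ← F.map_comp, Iso.hom_inv_id, F.map_id,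
      leftAdjointMate_id]⟩
  rw [← cancel_epi (F.obj D ◁ ((dualModuleIso F (D ⊙ᵣ leftDual X) X).inv ≫
    leftAdjointMate (F.map (αᵣ D (leftDual X) X).hom)))]
  have hδ : F.map ((ρᵣ[C] D).inv ≫ D ⊴ᵣ η_ (leftDual X) X) ≫
      F.map (αᵣ D (leftDual X) X).hom ≫ δᵣ F (D ⊙ᵣ leftDual X) X =
      (ρ_ (F.obj D)).inv ≫ F.obj D ◁ η_ (leftDual X) X ≫
        (α_ (F.obj D) (leftDual X) X).inv ≫ μᵣ F D (leftDual X) ▷ X := by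
    rw [map_actionAssocIso_hom_δᵣ, F.map_comp, Category.assoc, δᵣ_naturality_right_assoc,
      ← δᵣ_unitality_inv_assoc]
    rfl
  have hR : F.obj D ◁ ((dualModuleIso F (D ⊙ᵣ leftDual X) X).inv ≫
      leftAdjointMate (F.map (αᵣ D (leftDual X) X).hom)) ≫
      F.obj D ◁ leftAdjointMate (F.map (αᵣ D (leftDual X) X).inv) ≫
        F.obj D ◁ (dualModuleIso F (D ⊙ᵣ leftDual X) X).hom = 𝟙 _ := by
    rw [← MonoidalCategory.whiskerLeft_comp, ← MonoidalCategory.whiskerLeft_comp, Category.assoc,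
      reassoc_of% hα, Iso.inv_hom_id, MonoidalCategory.whiskerLeft_id]
  rw [reassoc_of% hR, whisker_exchange_assoc, MonoidalCategory.whiskerLeft_comp, Category.assoc,
    leftAdjointMate_comp_evaluation, whisker_exchange_assoc, dualModuleIso_inv_evaluation,
    ← comp_whiskerRight_assoc, ← comp_whiskerRight_assoc]
  rw [Category.assoc, hδ, ExactPairing.tensor_evaluation]
  generalize (μᵣ F D (leftDual X)) = m
  change F.obj D ⊗ leftDual X ⟶ F.obj (D ⊙ᵣ leftDual X) at m
  calc _ = 𝟙 _ ⊗≫ F.obj D ◁ (η_ (leftDual X) X ▷ leftDual X) ▷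
          leftDual (F.obj (D ⊙ᵣ leftDual X)) ⊗≫
        (m ▷ (X ⊗ leftDual X) ≫ F.obj (D ⊙ᵣ leftDual X) ◁ ε_ (leftDual X) X) ▷
          leftDual (F.obj (D ⊙ᵣ leftDual X)) ⊗≫
        ε_ (leftDual (F.obj (D ⊙ᵣ leftDual X))) (F.obj (D ⊙ᵣ leftDual X)) := by monoidal
    _ = 𝟙 _ ⊗≫ F.obj D ◁ (η_ (leftDual X) X ▷ leftDual X ⊗≫ leftDual X ◁ ε_ (leftDual X) X) ▷
          leftDual (F.obj (D ⊙ᵣ leftDual X)) ⊗≫ m ▷ leftDual (F.obj (D ⊙ᵣ leftDual X)) ≫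
            ε_ (leftDual (F.obj (D ⊙ᵣ leftDual X))) (F.obj (D ⊙ᵣ leftDual X)) := by
        rw [← whisker_exchange]; monoidal
    _ = _ := by rw [ExactPairing.evaluation_coevaluation'']; monoidal

end Duals

/-! ### The balancing condition on `B ◁ X` -/

section Balanced

variable {C : Type u₁} [Category.{v₁} C] [MonoidalCategory C] [LeftRigidCategory C]
  {M : Type u₂} [Category.{v₂} M] [MonoidalRightAction C M]
  {A : Type u₃} [Category.{v₃} A]

/-- The evaluation `(D ◁ X) ◁ ᘁX ⟶ D`. -/
def actionEval (D : M) (X : C) : (D ⊙ᵣ X) ⊙ᵣ leftDual X ⟶ D :=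
  (actionHomEquiv (leftDual X) X (D ⊙ᵣ X) D).symm (𝟙 _)

lemma actionEval_eq (D : M) (X : C) :
    actionEval D X = (αᵣ D X (leftDual X)).inv ≫ D ⊴ᵣ ε_ (leftDual X) X ≫ (ρᵣ D).hom := by
  change 𝟙 _ ⊵ᵣ leftDual X ≫ _ = _
  rw [id_actionHomLeft, Category.id_comp]

lemma actionHomEquiv_actionEval_comp {D E : M} (X : C) (f : D ⟶ E) :
    actionHomEquiv (leftDual X) X (D ⊙ᵣ X) E (actionEval D X ≫ f) = f ⊵ᵣ X := by
  rw [actionHomEquiv_naturality_right, actionEval, Equiv.apply_symm_apply, Category.id_comp]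

/-- A balanced dinatural family is determined on `B ◁ X` by its value on `B`. This is the
balancing condition at `B ◁ X`, precomposed with the evaluation
`((B ◁ X) ◁ ᘁX) ◁ X ⟶ B ◁ X`. -/
lemma IsBalanced.apply_action {S : Mᵒᵖ ⥤ M ⥤ A} {γ : Prebalancing C S} {T : A}
    {ξ : ∀ B : M, (S.obj (op B)).obj B ⟶ T} (hb : IsBalanced γ ξ) (hd : IsDinatural S ξ)
    (B : M) (X : C) :
    ξ (B ⊙ᵣ X) = (γ.iso X B (B ⊙ᵣ X)).hom ≫ (S.obj (op B)).map (actionEval B X) ≫ ξ B := by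
  have h := congrArg (fun t => (S.map ((αᵣ (B ⊙ᵣ X) (leftDual X) X).hom ≫
    actionEval B X ⊵ᵣ X).op).app (B ⊙ᵣ X) ≫ t) (hb X (B ⊙ᵣ X))
  have hzig : (((ρᵣ[C] (B ⊙ᵣ X)).inv ≫ (B ⊙ᵣ X) ⊴ᵣ η_ (leftDual X) X) ≫
      (αᵣ (B ⊙ᵣ X) (leftDual X) X).hom) ≫ actionEval B X ⊵ᵣ X = 𝟙 _ := by
    have := actionHomEquiv_actionEval_comp X (𝟙 B)
    rw [Category.comp_id, id_actionHomLeft, actionHomEquiv_apply] at this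
    rw [Category.assoc, Category.assoc, this]
  simp only [← Category.assoc, ← NatTrans.comp_app, ← S.map_comp, ← op_comp] at h
  rw [hzig, Iso.inv_hom_id, Category.id_comp, γ.naturality_fst, op_id, S.map_id, NatTrans.id_app,
    Category.id_comp, Category.assoc, hd] at h
  exact h

end Balanced

/-! ### The relative coend from a representation of `Hom(F(-), 𝟙)` -/

section UniversalMorphism

variable {C : Type u₁} [Category.{v₁} C] [MonoidalCategory C] {M : Type u₂} [Category.{v₂} M]

variable {F : M ⥤ C} {B : M} (R : (F.op ⋙ yoneda.obj (𝟙_ C)).RepresentableBy B)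

/-- The universal morphism `F(B) ⟶ 𝟙` of a representation of `Hom(F(-), 𝟙)` by `B`. -/
def reprEv : F.obj B ⟶ 𝟙_ C := R.homEquiv (𝟙 B)

lemma map_comp_reprEv {D : M} (f : D ⟶ B) : F.map f ≫ reprEv R = R.homEquiv f :=
  (R.homEquiv_eq f).symm

lemma reprEv_hom_ext {D : M} {f g : D ⟶ B} (h : F.map f ≫ reprEv R = F.map g ≫ reprEv R) :
    f = g := by
  rw [map_comp_reprEv, map_comp_reprEv] at h
  exact R.homEquiv.injective h

end UniversalMorphism

section CoendOfRepresentation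

variable {C : Type u₁} [Category.{v₁} C] [MonoidalCategory C] [LeftRigidCategory C]
  {M : Type u₂} [Category.{v₂} M] [MonoidalRightAction C M]
  {N : Type u₃} [Category.{v₃} N] [MonoidalRightAction C N]

open Functor.OplaxRightLinear Functor.LaxRightLinear

variable {F : M ⥤ C} {B : M} [F.RightLinear C]
  (R : (F.op ⋙ yoneda.obj (𝟙_ C)).RepresentableBy B)

/-- The morphism `D ◁ ᘁF(D) ⟶ B` corresponding to the evaluation
`F(D ◁ ᘁF(D)) ≅ F(D) ⊗ ᘁF(D) ⟶ 𝟙`. -/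
def reprπ (D : M) : D ⊙ᵣ leftDual (F.obj D) ⟶ B :=
  R.homEquiv.symm (δᵣ F D (leftDual (F.obj D)) ≫ ε_ (leftDual (F.obj D)) (F.obj D))

lemma map_reprπ_reprEv (D : M) : F.map (reprπ R D) ≫ reprEv R =
    δᵣ F D (leftDual (F.obj D)) ≫ ε_ (leftDual (F.obj D)) (F.obj D) := by
  rw [map_comp_reprEv, reprπ, Equiv.apply_symm_apply]

lemma map_actionHomRight_reprπ_reprEv (D : M) {P : C} (g : P ⟶ leftDual (F.obj D)) :
    F.map (D ⊴ᵣ g ≫ reprπ R D) ≫ reprEv R =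
      δᵣ F D P ≫ F.obj D ◁ g ≫ ε_ (leftDual (F.obj D)) (F.obj D) := by
  rw [F.map_comp, Category.assoc, map_reprπ_reprEv, δᵣ_naturality_right_assoc]
  rfl

lemma reprπ_dinatural {D D' : M} (f : D ⟶ D') :
    D ⊴ᵣ leftAdjointMate (F.map f) ≫ reprπ R D =
      f ⊵ᵣ leftDual (F.obj D') ≫ reprπ R D' := by
  apply reprEv_hom_ext R
  rw [map_actionHomRight_reprπ_reprEv, leftAdjointMate_comp_evaluation, F.map_comp, Category.assoc,
    map_reprπ_reprEv, δᵣ_naturality_left_assoc]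
  rfl

lemma reprπ_balanced (X : C) (D : M) :
    D ⊴ᵣ leftAdjointMate (F.map ((ρᵣ[C] D).inv ≫ D ⊴ᵣ η_ (leftDual X) X)) ≫ reprπ R D =
      D ⊴ᵣ leftAdjointMate (F.map (αᵣ D (leftDual X) X).inv) ≫
        D ⊴ᵣ (dualModuleIso F (D ⊙ᵣ leftDual X) X).hom ≫
          (αᵣ D (leftDual X) (leftDual (F.obj (D ⊙ᵣ leftDual X)))).hom ≫
            reprπ R (D ⊙ᵣ leftDual X) := by
  apply reprEv_hom_ext R
  rw [map_actionHomRight_reprπ_reprEv, leftAdjointMate_comp_evaluation]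
  have h₁ : F.map (αᵣ D (leftDual X) (leftDual (F.obj (D ⊙ᵣ leftDual X)))).hom ≫
      F.map (reprπ R (D ⊙ᵣ leftDual X)) ≫ reprEv R =
      δᵣ F D (leftDual X ⊗ leftDual (F.obj (D ⊙ᵣ leftDual X))) ≫
        (α_ (F.obj D) (leftDual X) (leftDual (F.obj (D ⊙ᵣ leftDual X)))).inv ≫
          μᵣ F D (leftDual X) ▷ leftDual (F.obj (D ⊙ᵣ leftDual X)) ≫ ε_ _ _ := by
    rw [map_reprπ_reprEv, ← Category.assoc, map_actionAssocIso_hom_δᵣ, Category.assoc,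
      Category.assoc]
    rfl
  rw [F.map_comp (D ⊴ᵣ _), F.map_comp (D ⊴ᵣ _), F.map_comp (actionAssocIso _ _ _).hom,
    Category.assoc, Category.assoc, Category.assoc, h₁,
    δᵣ_naturality_right_assoc, δᵣ_naturality_right_assoc]
  exact congrArg (_ ≫ ·) (map_coev_evaluation F D X)

variable (G : M ⥤ N) [G.RightLinear C]

/-- The family `G(D) ◁ ᘁF(D) ≅ G(D ◁ ᘁF(D)) ⟶ G(B)`. -/
def reprCoendπ (D : M) : G.obj D ⊙ᵣ leftDual (F.obj D) ⟶ G.obj B :=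
  μᵣ G D (leftDual (F.obj D)) ≫ G.map (reprπ R D)

lemma reprCoendπ_isDinatural : IsDinatural (dualBifunctor F G) (reprCoendπ R G) := by
  intro D D' f
  change G.obj D ⊴ᵣ leftAdjointMate (F.map f) ≫ μᵣ G D _ ≫ G.map (reprπ R D) =
    G.map f ⊵ᵣ leftDual (F.obj D') ≫ μᵣ G D' _ ≫ G.map (reprπ R D')
  rw [μᵣ_naturality_right_assoc, μᵣ_naturality_left_assoc, ← G.map_comp, ← G.map_comp,
    reprπ_dinatural]

lemma reprCoendπ_isBalanced : IsBalanced (dualPrebalancing F G) (reprCoendπ R G) := by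
  intro X D
  change G.obj D ⊴ᵣ leftAdjointMate (F.map ((ρᵣ[C] D).inv ≫ D ⊴ᵣ η_ (leftDual X) X)) ≫
      μᵣ G D _ ≫ G.map (reprπ R D) =
    G.obj D ⊴ᵣ leftAdjointMate (F.map (αᵣ D (leftDual X) X).inv) ≫
      (dualPrebalancingIso F G X (D ⊙ᵣ leftDual X) D).hom ≫
        μᵣ G (D ⊙ᵣ leftDual X) _ ≫ G.map (reprπ R (D ⊙ᵣ leftDual X))
  rw [dualPrebalancingIso_hom, μᵣ_naturality_right_assoc, ← G.map_comp, reprπ_balanced]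
  simp only [G.map_comp, Category.assoc]
  rw [← μᵣ_naturality_right_assoc, ← μᵣ_naturality_right_assoc, μᵣ_associativity_assoc]

/-- The morphism `B ≅ B ◁ 𝟙 ⟶ B ◁ ᘁF(B) ⟶ B` is the identity. -/
lemma reprπ_coname_reprEv :
    (ρᵣ[C] B).inv ≫ B ⊴ᵣ coname (reprEv R) ≫ reprπ R B = 𝟙 B := by
  apply reprEv_hom_ext R
  rw [F.map_comp, Category.assoc, map_actionHomRight_reprπ_reprEv, whiskerLeft_coname_evaluation,
    ← δᵣ_unitality_inv_assoc, F.map_id, Category.id_comp]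
  exact Iso.inv_hom_id_assoc (ρ_ (F.obj B)) _

/-- The morphism `G(B) ⟶ T` induced by a family `ξ D : G(D) ◁ ᘁF(D) ⟶ T`. -/
def reprCoendDesc {T : N} (ξ : ∀ D : M, G.obj D ⊙ᵣ leftDual (F.obj D) ⟶ T) : G.obj B ⟶ T :=
  (ρᵣ[C] (G.obj B)).inv ≫ G.obj B ⊴ᵣ coname (reprEv R) ≫ ξ B

lemma reprCoendDesc_comp_reprCoendπ {T : N} (f : G.obj B ⟶ T) :
    reprCoendDesc R G (fun D => reprCoendπ R G D ≫ f) = f := by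
  have h := congrArg (fun t => G.map t ≫ f) (reprπ_coname_reprEv R)
  simp only [G.map_comp, ← μᵣ_unitality_inv, Category.assoc, ← μᵣ_naturality_right_assoc, G.map_id,
    Category.id_comp] at h
  rw [reprCoendDesc, reprCoendπ, Category.assoc]
  exact h

/-- The image under a module functor of a zigzag identity for `X`. -/
lemma μᵣ_actionHomEquiv_map_actionEval (D : M) (X : C) :
    μᵣ G D X ≫ actionHomEquiv (leftDual X) X (G.obj (D ⊙ᵣ X)) (G.obj D)
      (μᵣ G (D ⊙ᵣ X) (leftDual X) ≫ G.map (actionEval D X)) = 𝟙 _ := by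
  rw [← actionHomEquiv_naturality_left, ← Equiv.eq_symm_apply]
  change _ = actionEval (G.obj D) X
  rw [actionEval_eq, actionEval_eq, G.map_comp, G.map_comp, μᵣ_associativity_inv_assoc,
    ← μᵣ_naturality_right_assoc, ← μᵣ_unitality]

/-- A balanced dinatural family factors through `reprCoendπ`: dinaturality along `reprπ` expresses
the composite through `ξ` at `D ◁ ᘁF(D)`, and balancing brings it back to `ξ D`. -/
lemma reprCoendπ_desc {T : N} (ξ : ∀ D : M, G.obj D ⊙ᵣ leftDual (F.obj D) ⟶ T)
    (hd : IsDinatural (dualBifunctor F G) ξ) (hb : IsBalanced (dualPrebalancing F G) ξ) (D : M) :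
    reprCoendπ R G D ≫ reprCoendDesc R G ξ = ξ D := by
  let X := leftDual (F.obj D)
  have h₁ : G.obj (D ⊙ᵣ X) ⊴ᵣ leftAdjointMate (F.map (reprπ R D)) ≫ ξ (D ⊙ᵣ X) =
      G.map (reprπ R D) ⊵ᵣ leftDual (F.obj B) ≫ ξ B := hd (reprπ R D)
  have h₂ : ξ (D ⊙ᵣ X) = (dualPrebalancingIso F G X D (D ⊙ᵣ X)).hom ≫
      G.map (actionEval D X) ⊵ᵣ leftDual (F.obj D) ≫ ξ D := hb.apply_action hd D X
  have h₃ := coname_comp (F.map (reprπ R D)) (reprEv R)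
  rw [map_reprπ_reprEv, coname_evaluation] at h₃
  rw [reprCoendDesc, reprCoendπ, Category.assoc, ← actionUnitIso_inv_naturality_assoc (C := C),
    ← action_exchange_assoc, ← h₁, ← actionHomRight_comp_assoc, h₃, h₂, dualPrebalancingIso_hom,
    actionHomRight_comp_assoc]
  have h₆ : G.obj (D ⊙ᵣ X) ⊴ᵣ (dualModuleIso F D X).inv ≫
      G.obj (D ⊙ᵣ X) ⊴ᵣ (dualModuleIso F D X).hom = 𝟙 _ := actionHomRight_inv_hom _ _
  simp only [Category.assoc]
  rw [reassoc_of% h₆]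
  have h₄ := μᵣ_actionHomEquiv_map_actionEval G D X
  rw [actionHomEquiv_apply, comp_actionHomLeft] at h₄
  have h₅ := congrArg (· ≫ ξ D) h₄
  simp only [Category.assoc, Category.id_comp] at h₅
  exact h₅

/-- If `B` represents `Hom(F(-), 𝟙)`, then `G(B)` is the relative coend of
`(E, D) ↦ G(D) ◁ ᘁF(E)`. -/
def reprCoend : RelativeCoend (dualPrebalancing F G) where
  pt := G.obj B
  π := reprCoendπ R G
  dinatural := reprCoendπ_isDinatural R G
  balanced := reprCoendπ_isBalanced R G
  desc ξ _ _ := reprCoendDesc R G ξ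
  fac ξ hd hb D := reprCoendπ_desc R G ξ hd hb D
  hom_ext {T f g} h := by
    rw [← reprCoendDesc_comp_reprCoendπ R G f, ← reprCoendDesc_comp_reprCoendπ R G g]
    exact congrArg (reprCoendDesc R G) (funext h)

end CoendOfRepresentation

/-! ### The module functor recovered from its relative coend -/

section CoendUnit

variable {C : Type u₁} [Category.{v₁} C] [MonoidalCategory C] [LeftRigidCategory C]
  {M : Type u₂} [Category.{v₂} M] [MonoidalRightAction C M]

open Functor.OplaxRightLinear Functor.LaxRightLinear

/-- Relative coends are unique up to isomorphism. -/
def RelativeCoend.uniqueUpToIso {A : Type u₃} [Category.{v₃} A] {S : Mᵒᵖ ⥤ M ⥤ A}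
    {γ : Prebalancing C S} (E E' : RelativeCoend γ) : E.pt ≅ E'.pt where
  hom := E.desc E'.π E'.dinatural E'.balanced
  inv := E'.desc E.π E.dinatural E.balanced
  hom_inv_id := E.hom_ext fun B => by
    rw [← Category.assoc, E.fac, E'.fac, Category.comp_id]
  inv_hom_id := E'.hom_ext fun B => by
    rw [← Category.assoc, E'.fac, E.fac, Category.comp_id]

lemma RelativeCoend.π_uniqueUpToIso_hom {A : Type u₃} [Category.{v₃} A] {S : Mᵒᵖ ⥤ M ⥤ A}
    {γ : Prebalancing C S} (E E' : RelativeCoend γ) (B : M) :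
    E.π B ≫ (E.uniqueUpToIso E').hom = E'.π B :=
  E.fac _ _ _ B

lemma actionHomEquiv_leftAdjointMate {P Q : C} (f : P ⟶ Q) {D E : M}
    (g : D ⊙ᵣ leftDual P ⟶ E) :
    actionHomEquiv (leftDual Q) Q D E (D ⊴ᵣ leftAdjointMate f ≫ g) =
      actionHomEquiv (leftDual P) P D E g ≫ E ⊴ᵣ f :=
  actionHomEquiv_mate _ _ (coevaluation_comp_leftAdjointMate f).symm g

variable {F : M ⥤ C} [F.RightLinear C] (E : RelativeCoend (dualPrebalancing F (𝟭 M)))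

/-- The morphism `D ◁ ᘁF(D) ⟶ ∮ D ◁ ᘁF(D)`. -/
abbrev coendIncl (D : M) : D ⊙ᵣ leftDual (F.obj D) ⟶ E.pt := E.π D

/-- The morphism `D ⟶ (∮ D ◁ ᘁF(D)) ◁ F(D)` adjunct to the dinatural transformation of the
relative coend. -/
def coendUnit (D : M) : D ⟶ E.pt ⊙ᵣ F.obj D :=
  actionHomEquiv (leftDual (F.obj D)) (F.obj D) D E.pt (coendIncl E D)

lemma coendUnit_comp_actionHomRight (D : M) {Z : C} (g : F.obj D ⟶ Z) :
    coendUnit E D ≫ E.pt ⊴ᵣ g =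
      actionHomEquiv (leftDual Z) Z D E.pt (D ⊴ᵣ leftAdjointMate g ≫ coendIncl E D) :=
  (actionHomEquiv_leftAdjointMate g _).symm

lemma coendUnit_naturality {D D' : M} (f : D ⟶ D') :
    coendUnit E D ≫ E.pt ⊴ᵣ F.map f = f ≫ coendUnit E D' := by
  rw [coendUnit_comp_actionHomRight, coendUnit, ← actionHomEquiv_naturality_left]
  exact congrArg _ (E.dinatural f)

/-- `coendUnit` is a module transformation, because the relative coend is balanced. -/
lemma coendUnit_comp_δᵣ (D : M) (X : C) :
    coendUnit E (D ⊙ᵣ X) ≫ E.pt ⊴ᵣ δᵣ F D X =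
      coendUnit E D ⊵ᵣ X ≫ (αᵣ E.pt (F.obj D) X).inv := by
  have h₁ : coendIncl E (D ⊙ᵣ X) = (dualPrebalancingIso F (𝟭 M) X D (D ⊙ᵣ X)).hom ≫
      actionEval D X ⊵ᵣ leftDual (F.obj D) ≫ coendIncl E D :=
    E.balanced.apply_action E.dinatural D X
  have h₂ : (dualPrebalancingIso F (𝟭 M) X D (D ⊙ᵣ X)).hom =
      (D ⊙ᵣ X) ⊴ᵣ (dualModuleIso F D X).hom ≫
        (αᵣ (D ⊙ᵣ X) (leftDual X) (leftDual (F.obj D))).hom := by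
    rw [dualPrebalancingIso_hom]
    change _ ≫ _ ≫ 𝟙 ((D ⊙ᵣ X) ⊙ᵣ leftDual X) ⊵ᵣ _ = _
    rw [id_actionHomLeft, Category.comp_id]
    rfl
  refine (actionHomEquiv_mate (X := leftDual X ⊗ leftDual (F.obj D)) (Y := F.obj D ⊗ X)
    (dualModuleIso F D X).inv (δᵣ F D X)
    (coevaluation_dualModuleIso_inv F D X).symm _).symm.trans ?_
  rw [h₁, h₂, Category.assoc, actionHomRight_inv_hom_assoc, actionHomEquiv_tensorPairing,
    Iso.inv_hom_id_assoc, actionHomEquiv_naturality_left, actionHomEquiv_actionEval_comp]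
  rfl

section

variable {B : M} (R : (F.op ⋙ yoneda.obj (𝟙_ C)).RepresentableBy B)

/-- A representing object of `Hom(F(-), 𝟙)` is isomorphic to the relative coend of
`(E, D) ↦ D ◁ ᘁF(E)`. -/
def reprCoendIso : B ≅ E.pt := (reprCoend R (𝟭 M)).uniqueUpToIso E

lemma reprπ_reprCoendIso (D : M) : reprπ R D ≫ (reprCoendIso E R).hom = coendIncl E D :=
  (congrArg (· ≫ (reprCoendIso E R).hom) (Category.id_comp (reprπ R D)).symm).trans
    ((reprCoend R (𝟭 M)).π_uniqueUpToIso_hom E D)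

lemma reprπ_hom_ext {T : M} {f g : B ⟶ T} (h : ∀ D, reprπ R D ≫ f = reprπ R D ≫ g) : f = g :=
  (reprCoend R (𝟭 M)).hom_ext fun D =>
    (congrArg (· ≫ f) (Category.id_comp (reprπ R D))).trans
      ((h D).trans (congrArg (· ≫ g) (Category.id_comp (reprπ R D)).symm))

end

/-- If `Hom(F(-), 𝟙)` is representable, then `F` is left adjoint to `(∮ D ◁ ᘁF(D)) ◁ -`, with
unit `coendUnit`. -/
lemma coendUnit_bijective {B : M} (R : (F.op ⋙ yoneda.obj (𝟙_ C)).RepresentableBy B) (D : M)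
    (Z : C) : Function.Bijective (fun g : F.obj D ⟶ Z => coendUnit E D ≫ E.pt ⊴ᵣ g) := by
  let i := reprCoendIso E R
  let e : (F.obj D ⟶ Z) ≃ (D ⟶ E.pt ⊙ᵣ Z) :=
    (Iso.homToEquiv (λ_ Z).symm).trans <|
      (tensorRightHomEquiv (F.obj D) (leftDual Z) Z (𝟙_ C)).symm.trans <|
        (Iso.homFromEquiv (Functor.RightLinear.μᵣIso F D (leftDual Z))).trans <|
          R.homEquiv.symm.trans <|
            (Iso.homToEquiv i).trans (actionHomEquiv (leftDual Z) Z D E.pt)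
  convert! e.bijective using 1
  ext g
  rw [coendUnit_comp_actionHomRight, ← reprπ_reprCoendIso E R, ← Category.assoc]
  refine congrArg (fun t => actionHomEquiv (leftDual Z) Z D E.pt (t ≫ i.hom)) ?_
  rw [Equiv.eq_symm_apply, ← map_comp_reprEv, map_actionHomRight_reprπ_reprEv,
    leftAdjointMate_comp_evaluation]
  change _ = δᵣ F D (leftDual Z) ≫ (g ≫ (λ_ Z).inv) ▷ leftDual Z ≫
    (α_ (𝟙_ C) Z (leftDual Z)).hom ≫ 𝟙_ C ◁ ε_ (leftDual Z) Z ≫ (ρ_ (𝟙_ C)).hom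
  congr 1
  monoidal

end CoendUnit

/-! ### The functors `Φ(B)` and their relative coends -/

section RepresentationOfPhi

variable {C : Type u₁} [Category.{v₁} C] [MonoidalCategory C] [RigidCategory C]
  {M : Type u₂} [Category.{v₂} M] [MonoidalRightAction C M]
  (I : ∀ D B : M, InternalHom C D B)

/-- The adjunction between `Φ(B)` and `B ◁ -` represents `Hom(Φ(B)(-), 𝟙)` by `B ◁ 𝟙 ≅ B`. -/
def phiRepresentableBy (B : M) :
    ((phiFunctor I B).op ⋙ yoneda.obj (𝟙_ C)).RepresentableBy B where
  homEquiv {D} := (Iso.homToEquiv (ρᵣ[C] B).symm).trans (phiEquiv I B D (𝟙_ C)).symm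
  homEquiv_comp {D D'} f g := by
    apply (phiEquiv I B D (𝟙_ C)).injective
    refine (Equiv.apply_symm_apply _ _).trans ?_
    change _ = phiCoact I B D ≫ B ⊴ᵣ ((phiFunctor I B).map f ≫
      (phiEquiv I B D' (𝟙_ C)).symm (g ≫ (ρᵣ[C] B).inv))
    rw [actionHomRight_comp, ← Category.assoc (phiCoact I B D), phiCoact_naturality,
      Category.assoc]
    exact (Category.assoc _ _ _).trans
      (congrArg (f ≫ ·) ((phiEquiv I B D' (𝟙_ C)).apply_symm_apply _).symm)

/-- Up to adjunction, the coend family `D ◁ ᘁΦ(B)(D) ⟶ B` is the universal morphism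
`D ⟶ B ◁ Φ(B)(D)`. -/
lemma actionHomEquiv_reprπ_phi (B D : M) :
    actionHomEquiv _ _ D B (reprπ (phiRepresentableBy I B) D) = phiCoact I B D := by
  rw [← Equiv.eq_symm_apply, reprπ, Equiv.symm_apply_eq]
  apply (phiEquiv I B _ (𝟙_ C)).injective
  refine Eq.trans ?_ (Equiv.apply_symm_apply _ _).symm
  change phiCoact I B _ ≫ B ⊴ᵣ (phiδ I B D _ ≫ _) = (phiCoact I B D ⊵ᵣ _ ≫ (αᵣ B _ _).inv ≫
    B ⊴ᵣ ε_ _ ((phiFunctor I B).obj D) ≫ (ρᵣ[C] B).hom) ≫ (ρᵣ[C] B).inv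
  rw [actionHomRight_comp, ← Category.assoc, phiCoact_phiδ]
  simp only [Category.assoc, Iso.hom_inv_id, Category.comp_id]

lemma reprπ_phi_naturality {B B' : M} (b : B ⟶ B') (D : M) :
    reprπ (phiRepresentableBy I B) D ≫ b =
      D ⊴ᵣ leftAdjointMate (phiMapApp I b D) ≫ reprπ (phiRepresentableBy I B') D := by
  apply (actionHomEquiv _ ((phiFunctor I B).obj D) _ _).injective
  rw [actionHomEquiv_naturality_right, actionHomEquiv_leftAdjointMate, actionHomEquiv_reprπ_phi,
    actionHomEquiv_reprπ_phi, phiCoact_phiMapApp]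

variable {F : M ⥤ C} [F.RightLinear C] (E : RelativeCoend (dualPrebalancing F (𝟭 M)))

/-- The comparison morphism `Φ(∮ D ◁ ᘁF(D))(D) ⟶ F(D)`. -/
def phiComparison (D : M) : (phiFunctor I E.pt).obj D ⟶ F.obj D :=
  (phiEquiv I E.pt D (F.obj D)).symm (coendUnit E D)

lemma phiCoact_phiComparison (D : M) :
    phiCoact I E.pt D ≫ E.pt ⊴ᵣ phiComparison I E D = coendUnit E D :=
  (phiEquiv I E.pt D (F.obj D)).apply_symm_apply _

lemma phiComparison_naturality {D D' : M} (f : D ⟶ D') :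
    (phiFunctor I E.pt).map f ≫ phiComparison I E D' = phiComparison I E D ≫ F.map f := by
  apply phi_hom_ext
  rw [actionHomRight_comp, actionHomRight_comp, ← Category.assoc, ← Category.assoc,
    phiCoact_naturality, Category.assoc, phiCoact_phiComparison, phiCoact_phiComparison,
    coendUnit_naturality]

open Functor.OplaxRightLinear in
lemma phiComparison_δᵣ (D : M) (X : C) :
    phiComparison I E (D ⊙ᵣ X) ≫ δᵣ F D X = phiδ I E.pt D X ≫ phiComparison I E D ▷ X := by
  apply phi_hom_ext
  rw [actionHomRight_comp, actionHomRight_comp, ← Category.assoc, ← Category.assoc,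
    phiCoact_phiComparison, phiCoact_phiδ, coendUnit_comp_δᵣ, actionHomRight_whiskerRight,
    ← phiCoact_phiComparison I E D, comp_actionHomLeft]
  simp only [Category.assoc, Iso.inv_hom_id_assoc]

/-- Both `Φ(E)(D)` and `F(D)` corepresent `Hom(D, E ◁ -)`, where `E` is the relative coend. -/
lemma isIso_phiComparison {B : M} (R : (F.op ⋙ yoneda.obj (𝟙_ C)).RepresentableBy B) (D : M) :
    IsIso (phiComparison I E D) := by
  rw [isIso_iff_coyoneda_map_bijective]
  intro Z
  rw [← Function.Bijective.of_comp_iff' (phiEquiv I E.pt D Z).bijective]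
  convert! coendUnit_bijective E R D Z using 1
  ext g
  change phiCoact I E.pt D ≫ E.pt ⊴ᵣ (phiComparison I E D ≫ g) = _
  rw [actionHomRight_comp, ← Category.assoc, phiCoact_phiComparison]

end RepresentationOfPhi

/-! ### The quasi-inverse functors -/

section Equivalence

lemma RexModuleFunctor.isIso_of_isIso_app {k : Type w} [Field k] {C : Type u₁} [Category.{v₁} C]
    [MonoidalCategory C] {M : Type u₂} [Category.{v₂} M] [Preadditive M] [Linear k M]
    [MonoidalRightAction C M] {N : Type u₃} [Category.{v₃} N] [Preadditive N] [Linear k N]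
    [MonoidalRightAction C N] {F G : RexModuleFunctor k C M N} (θ : F ⟶ G)
    (h : ∀ D, IsIso (θ.natTrans.app D)) : IsIso θ := by
  have : IsIso θ.natTrans := NatIso.isIso_of_isIso_app _
  refine ⟨⟨inv θ.natTrans, fun D X => ?_⟩, ?_, ?_⟩
  · rw [NatIso.isIso_inv_app, NatIso.isIso_inv_app, IsIso.inv_comp_eq, ← Category.assoc, θ.comm,
      Category.assoc, ← comp_actionHomLeft, IsIso.hom_inv_id, id_actionHomLeft, Category.comp_id]
  · exact RexModuleFunctor.Hom.ext (IsIso.hom_inv_id θ.natTrans)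
  · exact RexModuleFunctor.Hom.ext (IsIso.inv_hom_id θ.natTrans)

variable (k : Type w) [Field k] {C : Type u₁} [Category.{v₁} C] [Abelian C] [Linear k C]
  [MonoidalCategory C] [RigidCategory C]
  {M : Type u₂} [Category.{v₂} M] [Abelian M] [Linear k M] [MonoidalRightAction C M]
  [IsFiniteModuleCategory k C M]

variable (M) in
lemma internalHom_nonempty [IsFiniteTensorCategory k C] (D B : M) :
    Nonempty (InternalHom C D B) := by
  have := IsFiniteModuleCategory.preservesFiniteColimits_actionLeft (k := k) (C := C) D
  have := isRepresentable_of_rightExact k (actionLeft C D) B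
  exact ⟨⟨_, Functor.representableBy _⟩⟩

lemma RexModuleFunctor.isRepresentable [IsFiniteTensorCategory k C]
    (F : RexModuleFunctor k C M C) : (F.functor.op ⋙ yoneda.obj (𝟙_ C)).IsRepresentable :=
  isRepresentable_of_rightExact k F.functor (𝟙_ C)

variable (I : ∀ D B : M, InternalHom C D B)
  (c : ∀ F : RexModuleFunctor k C M C, RelativeCoend (gammaPrebalancing F))

/-- The isomorphism `B ≅ ∮ D ◁ ᘁΦ(B)(D)`. -/
noncomputable def coendPhiIso (B : M) : B ≅ (c (phiObj k I B)).pt :=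
  reprCoendIso (F := phiFunctor I B) (c (phiObj k I B)) (phiRepresentableBy I B)

lemma reprπ_coendPhiIso (B D : M) :
    reprπ (phiRepresentableBy I B) D ≫ (coendPhiIso k I c B).hom =
      coendIncl (F := phiFunctor I B) (c (phiObj k I B)) D :=
  reprπ_reprCoendIso (F := phiFunctor I B) (c (phiObj k I B)) (phiRepresentableBy I B) D

lemma coendPhiIso_naturality {B B' : M} (b : B ⟶ B') :
    b ≫ (coendPhiIso k I c B').hom =
      (coendPhiIso k I c B).hom ≫ coendMap c ((phi k I).map b.op) := by
  refine reprπ_hom_ext (phiRepresentableBy I B) fun D => ?_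
  rw [← Category.assoc, reprπ_phi_naturality, Category.assoc, reprπ_coendPhiIso]
  refine Eq.trans (π_coendMap c ((phi k I).map b.op) D).symm ?_
  exact (congrArg (· ≫ coendMap c ((phi k I).map b.op)) (reprπ_coendPhiIso k I c B D).symm).trans
    (Category.assoc _ _ _)

/-- `∮ D ◁ ᘁΦ(B)(D)` is naturally isomorphic to `B`. -/
noncomputable def phiCompCoendIso : phi k I ⋙ coendFunctor c ≅ 𝟭 Mᵒᵖ :=
  NatIso.ofComponents (fun B => (coendPhiIso k I c B.unop).op)
    (fun b => congrArg Quiver.Hom.op (coendPhiIso_naturality k I c b.unop).symm)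

variable {k}

/-- The module transformation `Φ(∮ D ◁ ᘁF(D)) ⟶ F`. -/
noncomputable def phiCoendHom (F : RexModuleFunctor k C M C) :
    (phi k I).obj (op (c F).pt) ⟶ F where
  natTrans :=
    { app D := phiComparison I (c F) D
      naturality _ _ f := phiComparison_naturality I (c F) f }
  comm D X := phiComparison_δᵣ I (c F) D X

lemma phiCoendHom_naturality {F G : RexModuleFunctor k C M C} (θ : F ⟶ G) :
    (phi k I).map (coendMap c θ).op ≫ phiCoendHom I c G = phiCoendHom I c F ≫ θ := by
  ext D
  apply phi_hom_ext
  change phiCoact I (c F).pt D ≫ (c F).pt ⊴ᵣ (phiMapApp I (coendMap c θ) D ≫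
    phiComparison I (c G) D) = phiCoact I (c F).pt D ≫ (c F).pt ⊴ᵣ (phiComparison I (c F) D ≫
      θ.natTrans.app D)
  rw [actionHomRight_comp, actionHomRight_comp, ← Category.assoc, ← Category.assoc,
    phiCoact_phiMapApp, phiCoact_phiComparison, Category.assoc, ← action_exchange,
    ← Category.assoc, phiCoact_phiComparison, coendUnit_comp_actionHomRight, coendUnit,
    ← actionHomEquiv_naturality_right]
  exact congrArg _ (π_coendMap c θ D)

lemma isIso_phiCoendHom [IsFiniteTensorCategory k C] (F : RexModuleFunctor k C M C) :
    IsIso (phiCoendHom I c F) :=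
  RexModuleFunctor.isIso_of_isIso_app _ fun D =>
    have := F.isRepresentable
    isIso_phiComparison I (c F) (F.functor.op ⋙ yoneda.obj (𝟙_ C)).representableBy D

/-- `Φ(∮ D ◁ ᘁF(D))` is naturally isomorphic to `F`. -/
noncomputable def coendCompPhiIso [IsFiniteTensorCategory k C] :
    coendFunctor c ⋙ phi k I ≅ 𝟭 (RexModuleFunctor k C M C) :=
  NatIso.ofComponents
    (fun F => @asIso _ _ _ _ (phiCoendHom I c F) (isIso_phiCoendHom I c F))
    (fun θ => phiCoendHom_naturality I c θ)

end Equivalence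

end RelCoend

theorem mainTheorem5 {k : Type w} [Field k]
    {C : Type u₁} [Category.{v₁} C] [Abelian C] [Linear k C] [MonoidalCategory C]
    [RigidCategory C] [RelCoend.IsFiniteTensorCategory k C]
    {B : Type u₂} [Category.{v₂} B] [Abelian B] [Linear k B] [MonoidalRightAction C B]
    [RelCoend.IsFiniteModuleCategory k C B] :
    -- internal Homs exist, so that the functor `Φ` is defined
    (∀ D E : B, Nonempty (RelCoend.InternalHom C D E)) ∧
    -- the relative coend of `(D, E) ↦ E ◁ ᘁF(D)` exists in `B`
    (∀ F : RelCoend.RexModuleFunctor k C B C,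
      Nonempty (RelCoend.RelativeCoend (RelCoend.dualPrebalancing F.functor (𝟭 B)))) ∧
    -- for any choice of internal Homs and of relative coends, `F ↦ ∮ D ◁ ᘁF(D)` is a
    -- quasi-inverse of `Φ : Bᵒᵖ ⥤ Rex_C(B, C)`
    (∀ (I : ∀ D E : B, RelCoend.InternalHom C D E)
      (c : ∀ F : RelCoend.RexModuleFunctor k C B C,
        RelCoend.RelativeCoend (RelCoend.dualPrebalancing F.functor (𝟭 B))),
      Nonempty (RelCoend.phi k I ⋙ RelCoend.coendFunctor c ≅ 𝟭 Bᵒᵖ) ∧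
        Nonempty (RelCoend.coendFunctor c ⋙ RelCoend.phi k I ≅
          𝟭 (RelCoend.RexModuleFunctor k C B C))) ∧
    -- the relative coend of `(D, E) ↦ F'(E) ⊗ ᘁF(D)` exists in `C`
    (∀ F F' : RelCoend.RexModuleFunctor k C B C,
      Nonempty (RelCoend.RelativeCoend
        (RelCoend.dualPrebalancing F.functor F'.functor))) := by
  refine ⟨RelCoend.internalHom_nonempty k B, fun F => ?_, fun I c => ⟨⟨?_⟩, ⟨?_⟩⟩, fun F F' => ?_⟩
  · have := F.isRepresentable
    exact ⟨RelCoend.reprCoend (Functor.representableBy _) _⟩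
  · exact RelCoend.phiCompCoendIso k I c
  · exact RelCoend.coendCompPhiIso I c
  · have := F.isRepresentable
    exact ⟨RelCoend.reprCoend (Functor.representableBy _) _⟩
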